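/- Let $(M,\sigma,g)$ be a paraquaternionic Kähler manifold, that is: $M$ is a smooth manifold; $\sigma$ is a rank-3 subbundle of $\mathrm{End}(TM)$ which near each point has a canonical local basis $\{J_1,J_2,J_3\}$, meaning a smooth local basis with $$J_\alpha^2=-\epsilon_\alpha\,\mathrm{Id},\qquad J_\alpha J_{\alpha+1}=-J_{\alpha+1}J_\alpha=\epsilon_{\alpha+2}J_{\alpha+2}\qquad(\alpha\in\{1,2,3\}\bmod 3),\quad \epsilon_1=1,\ \epsilon_2=\epsilon_3=-1;$$ $g$ is a semi-Riemannian metric with $g(J_\alpha X,J_\alpha Y)=\epsilon_\alpha g(X,Y)$ for all vectors $X,Y$ and every canonical local basis of $\sigma$; and $\sigma$ is parallel with respect to the Levi-Civita connection of $g$. Let $N$ be an $n$-dimensional paraquaternionic CR-submanifold of $M$, that is: $N$ is an immersed submanifold on which $g$ restricts to a non-degenerate metric, together with a smooth distribution $\mathcal D\subseteq TN$, of some constant rank $r$, on which $g$ is non-degenerate, such that for every canonical local basis $\{J_1,J_2,J_3\}$ of $\sigma$ on an open set $U$, every $x\in U\cap N$ and every $\alpha$, $$J_\alpha\mathcal D_x=\mathcal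 D_x,\qquad J_\alpha\mathcal D^\perp_x\subseteq T_xN^\perp,$$ where $\mathcal D^\perp$ is the orthogonal complement of $\mathcal D$ in $TN$ and $T_xN^\perp$ is the normal space of $N$ at $x$. Then the totally real distribution $\mathcal D^\perp$ is integrable: the Lie bracket of any two smooth local sections of $\mathcal D^\perp$ is again a section of $\mathcal D^\perp$, and each point of $N$ has a smooth coordinate chart whose slices parallel to $\mathbb R^{n-r}\times\{0\}$ are integral manifolds of $\mathcal D^\perp$. Consequently there is exactly one foliation of $N$ (maximal smooth foliated atlas with leaves of dimension $n-r$) whose tangent distribution is $\mathcal D^\perp$; it is called the canonical totally real foliation $\mathfrak F^\perp$ of $N$. -/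

import Mathlib

open Set Manifold Bundle
open scoped Manifold ContDiff Topology

noncomputable section

namespace ParaquaternionicCR

section Ambient

variable (d : ℕ) (M : Type*) [TopologicalSpace M] [ChartedSpace (EuclideanSpace ℝ (Fin d)) M]
  [IsManifold (𝓡 d) ∞ M]

/-- A semi-Riemannian metric: a smooth field of symmetric non-degenerate bilinear forms on the
tangent spaces (of arbitrary signature). -/
structure SemiRiemannianMetric where
  /-- the scalar product on each tangent space -/
  toFun : ∀ x : M, TangentSpace (𝓡 d) x →L[ℝ] TangentSpace (𝓡 d) x →L[ℝ] ℝ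
  symm : ∀ (x : M) (v w : TangentSpace (𝓡 d) x), toFun x v w = toFun x w v
  nondegenerate : ∀ (x : M) (v : TangentSpace (𝓡 d) x), (∀ w, toFun x v w = 0) → v = 0
  contMDiff : ContMDiff (𝓡 d)
    ((𝓡 d).prod 𝓘(ℝ, EuclideanSpace ℝ (Fin d) →L[ℝ] EuclideanSpace ℝ (Fin d) →L[ℝ] ℝ)) ∞
    (fun x : M ↦ TotalSpace.mk'
      (EuclideanSpace ℝ (Fin d) →L[ℝ] EuclideanSpace ℝ (Fin d) →L[ℝ] ℝ)
      (E := fun x : M ↦ TangentSpace (𝓡 d) x →L[ℝ] TangentSpace (𝓡 d) x →L[ℝ] ℝ) x (toFun x))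

/-- A (not necessarily continuous) field of endomorphisms of the tangent spaces. -/
abbrev EndField := ∀ x : M, TangentSpace (𝓡 d) x →L[ℝ] TangentSpace (𝓡 d) x

variable {d M}

/-- Smoothness on `U` of a field of endomorphisms, as a section of the bundle `End(TM)`. -/
def SmoothEndOn (S : EndField d M) (U : Set M) : Prop :=
  ContMDiffOn (𝓡 d)
    ((𝓡 d).prod 𝓘(ℝ, EuclideanSpace ℝ (Fin d) →L[ℝ] EuclideanSpace ℝ (Fin d))) ∞
    (fun x : M ↦ TotalSpace.mk' (EuclideanSpace ℝ (Fin d) →L[ℝ] EuclideanSpace ℝ (Fin d))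
      (E := fun x : M ↦ TangentSpace (𝓡 d) x →L[ℝ] TangentSpace (𝓡 d) x) x (S x)) U

/-- The signs `ε₁ = 1`, `ε₂ = ε₃ = -1`; the indices `1, 2, 3` are written `0, 1, 2 : Fin 3`, so
that addition of indices is modulo 3. -/
def eps : Fin 3 → ℝ := ![1, -1, -1]

/-- `J₁, J₂, J₃` is a canonical local basis, on the open set `U`, of the field `σ` of spaces of
endomorphisms. -/
structure IsCanonicalLocalBasis
    (σ : ∀ x : M, Submodule ℝ (TangentSpace (𝓡 d) x →L[ℝ] TangentSpace (𝓡 d) x))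
    (U : Set M) (J : Fin 3 → EndField d M) : Prop where
  isOpen : IsOpen U
  smooth : ∀ α, SmoothEndOn (J α) U
  linearIndependent : ∀ x ∈ U, LinearIndependent ℝ (fun α ↦ J α x)
  span_eq : ∀ x ∈ U, Submodule.span ℝ (range fun α ↦ J α x) = σ x
  sq : ∀ x ∈ U, ∀ α, J α x ∘L J α x = -(eps α) • ContinuousLinearMap.id ℝ _
  mul : ∀ x ∈ U, ∀ α, J α x ∘L J (α + 1) x = eps (α + 2) • J (α + 2) x
  anticomm : ∀ x ∈ U, ∀ α, J α x ∘L J (α + 1) x = -(J (α + 1) x ∘L J α x)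

variable (d M) in
/-- An almost paraquaternionic structure: a rank-3 subbundle of `End(TM)` that has a canonical
local basis near each point. -/
structure AlmostParaquaternionicStructure where
  /-- the fibre of the subbundle at each point -/
  toFun : ∀ x : M, Submodule ℝ (TangentSpace (𝓡 d) x →L[ℝ] TangentSpace (𝓡 d) x)
  exists_basis : ∀ x : M, ∃ (U : Set M) (J : Fin 3 → EndField d M),
    x ∈ U ∧ IsCanonicalLocalBasis toFun U J

/-- The metric is adapted to the almost paraquaternionic structure, i.e. `(M, σ, g)` is an almost
paraquaternionic hermitian manifold. -/
def IsAdapted (σ : AlmostParaquaternionicStructure d M) (g : SemiRiemannianMetric d M) : Prop :=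
  ∀ (U : Set M) (J : Fin 3 → EndField d M), IsCanonicalLocalBasis σ.toFun U J →
    ∀ x ∈ U, ∀ (α : Fin 3) (v w : TangentSpace (𝓡 d) x),
      g.toFun x (J α x v) (J α x w) = eps α * g.toFun x v w

/-- The vector field `Y` is differentiable at `x`. -/
def VFDiffAt (Y : ∀ x : M, TangentSpace (𝓡 d) x) (x : M) : Prop :=
  MDifferentiableAt (𝓡 d) (𝓡 d).tangent (fun y : M ↦ (⟨y, Y y⟩ : TangentBundle (𝓡 d) M)) x

/-- `cov` is the Levi-Civita connection of `g`: it is torsion-free and metric. In Mathlib's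
convention, `cov Y x v` is `∇_v Y` at `x`. -/
structure IsLeviCivita (g : SemiRiemannianMetric d M)
    (cov : CovariantDerivative (𝓡 d) (EuclideanSpace ℝ (Fin d))
      (TangentSpace (𝓡 d) : M → Type _)) : Prop where
  torsion_eq_zero : cov.torsion = 0
  metric : ∀ (x : M) (v : TangentSpace (𝓡 d) x) (Y Z : ∀ x : M, TangentSpace (𝓡 d) x),
    VFDiffAt Y x → VFDiffAt Z x →
      mvfderiv (𝓡 d) (fun y ↦ g.toFun y (Y y) (Z y)) x v =
        g.toFun x (cov Y x v) (Z x) + g.toFun x (Y x) (cov Z x v)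

/-- The subbundle `σ` of `End(TM)` is parallel: for each smooth local section `S` of `σ` and each
tangent vector `v` at a point `x` of its domain, the covariant derivative `B = (∇_v S)_x`,
which is given by `(∇_v S) Y = ∇_v (S Y) - S (∇_v Y)`, lies in `σ_x`. -/
def IsParallel (σ : AlmostParaquaternionicStructure d M)
    (cov : CovariantDerivative (𝓡 d) (EuclideanSpace ℝ (Fin d))
      (TangentSpace (𝓡 d) : M → Type _)) : Prop :=
  ∀ (U : Set M) (S : EndField d M), IsOpen U → SmoothEndOn S U → (∀ y ∈ U, S y ∈ σ.toFun y) →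
    ∀ x ∈ U, ∀ v : TangentSpace (𝓡 d) x, ∃ B ∈ σ.toFun x,
      ∀ Y : (∀ x : M, TangentSpace (𝓡 d) x), VFDiffAt Y x →
        B (Y x) = cov (fun y ↦ S y (Y y)) x v - S x (cov Y x v)

/-- `(M, σ, g)` is a paraquaternionic Kähler manifold. -/
structure IsParaquaternionicKahler (σ : AlmostParaquaternionicStructure d M)
    (g : SemiRiemannianMetric d M) : Prop where
  adapted : IsAdapted σ g
  parallel : ∃ cov : CovariantDerivative (𝓡 d) (EuclideanSpace ℝ (Fin d))
    (TangentSpace (𝓡 d) : M → Type _), IsLeviCivita g cov ∧ IsParallel σ cov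

end Ambient

section Distributions

variable {n : ℕ} {N : Type*} [TopologicalSpace N] [ChartedSpace (EuclideanSpace ℝ (Fin n)) N]
  [IsManifold (𝓡 n) ∞ N]

/-- Smoothness of a vector field on a set. -/
def VFSmoothOn (X : ∀ x : N, TangentSpace (𝓡 n) x) (U : Set N) : Prop :=
  ContMDiffOn (𝓡 n) (𝓡 n).tangent ∞ (fun x : N ↦ (⟨x, X x⟩ : TangentBundle (𝓡 n) N)) U

/-- `D` is a smooth distribution of rank `r`, i.e. a rank-`r` subbundle of `TN`: near each point
it has a smooth frame of `r` vector fields. -/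
def IsDistribution (r : ℕ) (D : ∀ x : N, Submodule ℝ (TangentSpace (𝓡 n) x)) : Prop :=
  ∀ x₀ : N, ∃ (U : Set N) (X : Fin r → ∀ x : N, TangentSpace (𝓡 n) x), IsOpen U ∧ x₀ ∈ U ∧
    (∀ i, VFSmoothOn (X i) U) ∧
    ∀ x ∈ U, LinearIndependent ℝ (fun i ↦ X i x) ∧ Submodule.span ℝ (range fun i ↦ X i x) = D x

/-- `D` is involutive: the Lie bracket of two smooth local sections of `D` is a section of `D`. -/
def IsInvolutive (D : ∀ x : N, Submodule ℝ (TangentSpace (𝓡 n) x)) : Prop :=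
  ∀ (W : Set N) (X Y : ∀ x : N, TangentSpace (𝓡 n) x), IsOpen W →
    VFSmoothOn X W → VFSmoothOn Y W → (∀ x ∈ W, X x ∈ D x) → (∀ x ∈ W, Y x ∈ D x) →
      ∀ x ∈ W, VectorField.mlieBracket (𝓡 n) X Y x ∈ D x

/-- The subspace `ℝᵖ × {0}` of `ℝⁿ`. Its translates are the model leaves. -/
def modelLeaf (n p : ℕ) : Submodule ℝ (EuclideanSpace ℝ (Fin n)) where
  carrier := {v | ∀ i : Fin n, p ≤ i.val → v i = 0}
  zero_mem' := by
    intro i _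
    simp
  add_mem' := by
    intro a b ha hb i hi
    simp [ha i hi, hb i hi]
  smul_mem' := by
    intro c a ha i hi
    simp [ha i hi]

/-- The chart `φ` is flat for `D`: it carries `D` to the constant distribution `ℝᵖ × {0}`, so that
the slices of `φ` parallel to `ℝᵖ × {0}` are integral manifolds of `D`. -/
def IsFlatOn (p : ℕ) (D : ∀ x : N, Submodule ℝ (TangentSpace (𝓡 n) x))
    (φ : OpenPartialHomeomorph N (EuclideanSpace ℝ (Fin n))) : Prop :=
  ∀ x ∈ φ.source, ∀ v : TangentSpace (𝓡 n) x,
    v ∈ D x ↔ mvfderiv (𝓡 n) φ x v ∈ modelLeaf n p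

/-- The rank-`p` distribution `D` is (completely) integrable: near each point of `N` there are
smooth coordinates whose slices parallel to `ℝᵖ × {0}` are integral manifolds of `D`. -/
def IsIntegrable (p : ℕ) (D : ∀ x : N, Submodule ℝ (TangentSpace (𝓡 n) x)) : Prop :=
  ∀ x : N, ∃ φ ∈ IsManifold.maximalAtlas (𝓡 n) ∞ N, x ∈ φ.source ∧ IsFlatOn p D φ

/-- The transition map `ψ ∘ φ⁻¹` maps, locally, points with the same last `n - p` coordinates
to points with the same last `n - p` coordinates; i.e. it is locally of the form
`(x, y) ↦ (h₁(x, y), h₂(y))`. -/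
def PlaqueCompatible (p : ℕ) (φ ψ : OpenPartialHomeomorph N (EuclideanSpace ℝ (Fin n))) : Prop :=
  ∀ z ∈ (φ.symm.trans ψ).source, ∃ W : Set (EuclideanSpace ℝ (Fin n)), IsOpen W ∧ z ∈ W ∧
    W ⊆ (φ.symm.trans ψ).source ∧
    ∀ a ∈ W, ∀ b ∈ W, a - b ∈ modelLeaf n p → ψ (φ.symm a) - ψ (φ.symm b) ∈ modelLeaf n p

variable (n N) in
/-- A smooth foliation of `N` by `p`-dimensional leaves: a maximal foliated atlas. -/
@[ext]
structure Foliation (p : ℕ) where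
  /-- the foliated charts -/
  atlas : Set (OpenPartialHomeomorph N (EuclideanSpace ℝ (Fin n)))
  subset_maximalAtlas : atlas ⊆ IsManifold.maximalAtlas (𝓡 n) ∞ N
  covers : ∀ x : N, ∃ φ ∈ atlas, x ∈ φ.source
  compatible : ∀ φ ∈ atlas, ∀ ψ ∈ atlas, PlaqueCompatible p φ ψ
  maximal : ∀ φ ∈ IsManifold.maximalAtlas (𝓡 n) ∞ N,
    (∀ ψ ∈ atlas, PlaqueCompatible p φ ψ ∧ PlaqueCompatible p ψ φ) → φ ∈ atlas

/-- `D` is the structural distribution of the foliation: the tangent distribution to its leaves. -/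
def Foliation.HasStructuralDistribution {p : ℕ} (F : Foliation n N p)
    (D : ∀ x : N, Submodule ℝ (TangentSpace (𝓡 n) x)) : Prop :=
  ∀ φ ∈ F.atlas, IsFlatOn p D φ

end Distributions

section Submanifold

variable {d : ℕ} {M : Type*} [TopologicalSpace M] [ChartedSpace (EuclideanSpace ℝ (Fin d)) M]
  [IsManifold (𝓡 d) ∞ M]
  {n : ℕ} {N : Type*} [TopologicalSpace N] [ChartedSpace (EuclideanSpace ℝ (Fin n)) N]
  [IsManifold (𝓡 n) ∞ N]

/-- The metric induced on `N` by the map `ι : N → M`. -/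
def inducedMetric (g : SemiRiemannianMetric d M) (ι : N → M) (x : N)
    (v w : TangentSpace (𝓡 n) x) : ℝ :=
  g.toFun (ι x) (mfderiv (𝓡 n) (𝓡 d) ι x v) (mfderiv (𝓡 n) (𝓡 d) ι x w)

/-- The induced metric is non-degenerate on each of the given subspaces of the tangent spaces. -/
def IsNondegenerateOn (g : SemiRiemannianMetric d M) (ι : N → M)
    (D : ∀ x : N, Submodule ℝ (TangentSpace (𝓡 n) x)) : Prop :=
  ∀ x : N, ∀ v ∈ D x, (∀ w ∈ D x, inducedMetric g ι x v w = 0) → v = 0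

/-- The orthogonal complementary distribution `D^⊥` of `D` in `TN`. -/
def orthDistribution (g : SemiRiemannianMetric d M) (ι : N → M)
    (D : ∀ x : N, Submodule ℝ (TangentSpace (𝓡 n) x)) (x : N) :
    Submodule ℝ (TangentSpace (𝓡 n) x) where
  carrier := {v | ∀ w ∈ D x, inducedMetric g ι x v w = 0}
  zero_mem' := by
    intro w _
    simp [inducedMetric]
  add_mem' := by
    intro a b ha hb w hw
    have h1 := ha w hw
    have h2 := hb w hw
    simp only [inducedMetric] at h1 h2 ⊢
    simp [h1, h2]
  smul_mem' := by
    intro c a ha w hw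
    have h1 := ha w hw
    simp only [inducedMetric] at h1 ⊢
    simp [h1]

/-- The vector `u` is normal to `N` at `x`, i.e. it lies in `T_x N^⊥`. -/
def IsNormalAt (n : ℕ) {N : Type*} [TopologicalSpace N]
    [ChartedSpace (EuclideanSpace ℝ (Fin n)) N]
    (g : SemiRiemannianMetric d M) (ι : N → M) (x : N)
    (u : TangentSpace (𝓡 d) (ι x)) : Prop :=
  ∀ v : TangentSpace (𝓡 n) x, g.toFun (ι x) u (mfderiv (𝓡 n) (𝓡 d) ι x v) = 0

/-- `N`, immersed in `(M, σ, g)` by `ι`, is a paraquaternionic CR-submanifold, with `D` (of rank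
`r`) as its paraquaternionic distribution. -/
structure IsParaquaternionicCRSubmanifold (σ : AlmostParaquaternionicStructure d M)
    (g : SemiRiemannianMetric d M) (ι : N → M) (r : ℕ)
    (D : ∀ x : N, Submodule ℝ (TangentSpace (𝓡 n) x)) : Prop where
  isImmersion : IsImmersion (𝓡 n) (𝓡 d) ∞ ι
  nondegenerate : IsNondegenerateOn g ι
    (fun x : N ↦ (⊤ : Submodule ℝ (TangentSpace (𝓡 n) x)))
  isDistribution : IsDistribution r D
  nondegenerate_distribution : IsNondegenerateOn g ι D
  paraquaternionic : ∀ (U : Set M) (J : Fin 3 → EndField d M),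
    IsCanonicalLocalBasis σ.toFun U J → ∀ x : N, ι x ∈ U → ∀ α : Fin 3,
      J α (ι x) '' (mfderiv (𝓡 n) (𝓡 d) ι x '' (D x)) = mfderiv (𝓡 n) (𝓡 d) ι x '' (D x)
  totallyReal : ∀ (U : Set M) (J : Fin 3 → EndField d M),
    IsCanonicalLocalBasis σ.toFun U J → ∀ x : N, ι x ∈ U → ∀ α : Fin 3,
      ∀ v ∈ orthDistribution g ι D x,
        IsNormalAt n g ι x (J α (ι x) (mfderiv (𝓡 n) (𝓡 d) ι x v))

end Submanifold

end ParaquaternionicCR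

end

noncomputable section

set_option maxSynthPendingDepth 3

/-!
Let `X`, `Y` be sections of `D^⊥` and `Z` a tangent field of `N`, and put `Ω(u, v) = g(J u, v)` for
a member `J` of a canonical local basis of `σ`. Every endomorphism in `σ` sends `D^⊥` into the
normal space, so `Ω` vanishes between `D^⊥` and `TN`. As `σ` is parallel, differentiating this
relation leaves no term in the derivative of `J`, and with torsion freeness and the skewness of `Ω`
one gets `Ω([X, Y], Z) = 0`. Thus `J [X, Y]` is normal, which for a tangent vector means
`[X, Y] ∈ D^⊥` because `J D = D`.

That `D^⊥` is a smooth distribution follows by orthogonalising arbitrary smooth fields against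
local frames of `D`, with the coefficients given by Cramer's rule for the Gram matrix.

The rest is Frobenius' theorem. A local frame of an involutive distribution, normalised so that a
fixed linear projection sends it to a constant frame, commutes. Its multi-time flow is obtained
from the inverse function theorem applied to the integral equation on the space of continuous
paths, and flowing a transversal gives flat coordinates. The atlas of a foliation tangent to an
integrable distribution can only consist of all its flat charts, hence uniqueness.
-/

namespace ParaquaternionicCR

section Postcomposition

lemma exists_forall_mem_ball_norm_sub_lt {X E F : Type*} [TopologicalSpace X] [CompactSpace X]
    [SeminormedAddCommGroup E] [SeminormedAddCommGroup F] (f : C(E, F)) (γ : C(X, E)) {ε : ℝ}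
    (hε : 0 < ε) :
    ∃ δ > 0, ∀ t, ∀ y ∈ Metric.ball (γ t) δ, ‖f y - f (γ t)‖ < ε := by
  obtain ⟨δ, hδ, hclose⟩ := Metric.continuous_iff.1 (ContinuousMap.continuous_postcomp f) γ ε hε
  refine ⟨δ, hδ, fun t y hy ↦ ?_⟩
  have hshift : dist (γ + ContinuousMap.const X (y - γ t)) γ < δ := by
    rw [dist_eq_norm, add_sub_cancel_left]
    refine lt_of_le_of_lt ((ContinuousMap.norm_le _ (norm_nonneg _)).2 fun s ↦ le_rfl) ?_
    rwa [Metric.mem_ball, dist_eq_norm] at hy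
  have := (ContinuousMap.dist_apply_le_dist t).trans_lt (hclose _ hshift)
  simpa [dist_eq_norm] using this

universe u

variable {X : Type*} [TopologicalSpace X] [CompactSpace X] {E F : Type u}
  [NormedAddCommGroup E] [NormedSpace ℝ E] [NormedAddCommGroup F] [NormedSpace ℝ F]

variable (X E F) in
/-- Pointwise application of a continuous family of operators to a continuous family of vectors,
as a continuous bilinear map for the sup norms. -/
def pointwiseApply : C(X, E →L[ℝ] F) →L[ℝ] C(X, E) →L[ℝ] C(X, F) :=
  LinearMap.mkContinuous₂
    (LinearMap.mk₂ ℝ (fun A γ ↦ ⟨fun t ↦ A t (γ t), by fun_prop⟩)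
      (fun _ _ _ ↦ by ext; simp) (fun _ _ _ ↦ by ext; simp)
      (fun _ _ _ ↦ by ext; simp) (fun _ _ _ ↦ by ext; simp)) 1
    (fun A γ ↦ by
      refine (ContinuousMap.norm_le _ (by positivity)).2 fun t ↦ ?_
      rw [one_mul]
      exact ((A t).le_opNorm _).trans
        (by gcongr <;> exact ContinuousMap.norm_coe_le_norm _ _))

lemma hasFDerivAt_postcomp (f : C(E, F)) (f' : C(E, E →L[ℝ] F))
    (hf : ∀ x, HasFDerivAt f (f' x) x) (γ : C(X, E)) :
    HasFDerivAt (fun γ : C(X, E) ↦ f.comp γ) (pointwiseApply X E F (f'.comp γ)) γ := by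
  rw [hasFDerivAt_iff_isLittleO_nhds_zero, Asymptotics.isLittleO_iff]
  intro ε hε
  obtain ⟨δ, hδ, hclose⟩ := exists_forall_mem_ball_norm_sub_lt f' γ hε
  filter_upwards [Metric.ball_mem_nhds (0 : C(X, E)) hδ] with h hh
  refine (ContinuousMap.norm_le _ (by positivity)).2 fun t ↦ ?_
  have ht : ‖h t‖ ≤ ‖h‖ := ContinuousMap.norm_coe_le_norm h t
  have htδ : ‖h t‖ < δ := ht.trans_lt (by simpa using hh)
  have hmean : ‖f (γ t + h t) - f (γ t) - f' (γ t) (γ t + h t - γ t)‖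
      ≤ ε * ‖γ t + h t - γ t‖ :=
    (convex_ball (γ t) δ).norm_image_sub_le_of_norm_hasFDerivWithin_le'
      (fun y _ ↦ (hf y).hasFDerivWithinAt) (fun y hy ↦ (hclose t y hy).le)
      (Metric.mem_ball_self hδ) (by simpa using htδ)
  rw [add_sub_cancel_left] at hmean
  exact hmean.trans (by gcongr)

lemma contDiff_nat_postcomp (k : ℕ) {F : Type u} [NormedAddCommGroup F] [NormedSpace ℝ F]
    (f : C(E, F)) (hf : ContDiff ℝ k f) : ContDiff ℝ k (fun γ : C(X, E) ↦ f.comp γ) := by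
  induction k generalizing F with
  | zero => exact contDiff_zero.2 (ContinuousMap.continuous_postcomp f)
  | succ k ih =>
    push_cast at hf ⊢
    obtain ⟨f', hf'smooth, hf'⟩ := contDiff_succ_iff_hasFDerivAt.1 hf
    exact contDiff_succ_iff_hasFDerivAt.2
      ⟨_, (pointwiseApply X E F).contDiff.comp (ih ⟨f', hf'smooth.continuous⟩ hf'smooth),
        hasFDerivAt_postcomp f ⟨f', hf'smooth.continuous⟩ hf'⟩

theorem contDiff_postcomp {m : ℕ∞} (f : C(E, F)) (hf : ContDiff ℝ m f) :
    ContDiff ℝ m (fun γ : C(X, E) ↦ f.comp γ) :=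
  contDiff_iff_forall_nat_le.2 fun k hk ↦
    contDiff_nat_postcomp k f (hf.of_le (by exact_mod_cast hk))

end Postcomposition

section LocalInverse

variable {E F : Type*} [NormedAddCommGroup E] [NormedSpace ℝ E] [CompleteSpace E]
  [NormedAddCommGroup F] [NormedSpace ℝ F]

lemma exists_openPartialHomeomorph_of_hasFDerivAt_equiv {m : ℕ∞ω} (hm : 1 ≤ m) {f : E → F}
    {U : Set E} (hU : IsOpen U) (hf : ContDiffOn ℝ m f U) {a : E} (ha : a ∈ U) {f' : E ≃L[ℝ] F}
    (hf' : HasFDerivAt f (f' : E →L[ℝ] F) a) :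
    ∃ e : OpenPartialHomeomorph E F, a ∈ e.source ∧ e.source ⊆ U ∧ (e : E → F) = f ∧
      ContDiffOn ℝ m e.symm e.target ∧
      ∀ x ∈ e.source, ∃ A : E ≃L[ℝ] F, HasFDerivAt f (A : E →L[ℝ] F) x := by
  have hm' : m ≠ 0 := (zero_lt_one.trans_le hm).ne'
  have hfat (x : E) (hx : x ∈ U) : ContDiffAt ℝ m f x := (hf x hx).contDiffAt (hU.mem_nhds hx)
  set V : Set E := U ∩ fderiv ℝ f ⁻¹' range ((↑) : (E ≃L[ℝ] F) → E →L[ℝ] F)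
  have hV : IsOpen V :=
    (hf.continuousOn_fderiv_of_isOpen hU hm).isOpen_inter_preimage hU ContinuousLinearEquiv.isOpen
  have hderiv : ∀ x ∈ V, ∃ A : E ≃L[ℝ] F, HasFDerivAt f (A : E →L[ℝ] F) x := by
    rintro x ⟨hx, A, hA⟩
    exact ⟨A, hA ▸ ((hfat x hx).differentiableAt hm').hasFDerivAt⟩
  set e := ((hfat a ha).toOpenPartialHomeomorph f hf' hm').restrOpen V hV
  refine ⟨e, ⟨(hfat a ha).mem_toOpenPartialHomeomorph_source hf' hm', ha, f', hf'.fderiv.symm⟩,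
    fun x hx ↦ hx.2.1, rfl, fun y hy ↦ ?_, fun x hx ↦ hderiv x hx.2⟩
  have hy' := e.map_target hy
  obtain ⟨A, hA⟩ := hderiv _ hy'.2
  exact (e.contDiffAt_symm hy hA (hfat _ hy'.2.1)).contDiffWithinAt

end LocalInverse

section Primitive

variable {E : Type*} [NormedAddCommGroup E] [NormedSpace ℝ E]

variable (E) in
/-- The operator sending a path `γ` on the unit interval to its primitive `t ↦ ∫₀ᵗ γ`; it turns
an initial value problem into a fixed point equation in the space of paths. -/
def primitive : C(unitInterval, E) →L[ℝ] C(unitInterval, E) :=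
  LinearMap.mkContinuous
    { toFun := fun γ ↦ ⟨fun t ↦ ∫ s in (0 : ℝ)..t, γ (projIcc 0 1 zero_le_one s),
        (intervalIntegral.continuous_primitive (fun a b ↦
          (γ.continuous.comp continuous_projIcc).intervalIntegrable a b) 0).comp
            continuous_subtype_val⟩
      map_add' := fun γ η ↦ by
        ext t
        exact intervalIntegral.integral_add
          ((γ.continuous.comp continuous_projIcc).intervalIntegrable _ _)
          ((η.continuous.comp continuous_projIcc).intervalIntegrable _ _)
      map_smul' := fun c γ ↦ by
        ext t
        exact intervalIntegral.integral_smul c _ } 1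
    (fun γ ↦ by
      rw [one_mul]
      refine (ContinuousMap.norm_le _ (norm_nonneg _)).2 fun t ↦ ?_
      refine (intervalIntegral.norm_integral_le_of_norm_le_const
        (fun s _ ↦ ContinuousMap.norm_coe_le_norm γ _)).trans ?_
      rw [sub_zero, abs_of_nonneg t.2.1]
      exact mul_le_of_le_one_right (norm_nonneg _) t.2.2)

variable [CompleteSpace E]

lemma primitive_eq_sub {γ : C(unitInterval, E)} {c : ℝ → E}
    (hc : ∀ s : unitInterval, HasDerivAt c (γ s) s) (t : unitInterval) :
    primitive E γ t = c t - c 0 := by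
  refine intervalIntegral.integral_eq_sub_of_hasDerivAt (fun s hs ↦ ?_)
    ((γ.continuous.comp continuous_projIcc).intervalIntegrable _ _)
  rw [uIcc_of_le t.2.1] at hs
  have hs' : s ∈ Icc (0 : ℝ) 1 := ⟨hs.1, hs.2.trans t.2.2⟩
  rw [projIcc_of_mem zero_le_one hs']
  exact hc ⟨s, hs'⟩

lemma exists_hasDerivAt_primitive (γ : C(unitInterval, E)) :
    ∃ c : ℝ → E, (∀ s : unitInterval, HasDerivAt c (γ s) s) ∧
      ∀ t : unitInterval, c t = primitive E γ t := by
  refine ⟨fun t ↦ ∫ s in (0 : ℝ)..t, γ (projIcc 0 1 zero_le_one s), fun s ↦ ?_, fun _ ↦ rfl⟩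
  have := (γ.continuous.comp (continuous_projIcc (h := zero_le_one))).integral_hasStrictDerivAt 0 s
  simpa using this.hasDerivAt

end Primitive

section CommutingFrame

universe u

variable {H E : Type u} [NormedAddCommGroup H] [NormedSpace ℝ H]
  [NormedAddCommGroup E] [NormedSpace ℝ E]

/-- The vector fields `z ↦ F z u`, for `u : H`, commute at `z`. -/
def CommutesAt (F : E → H →L[ℝ] E) (z : E) : Prop :=
  ∀ u v, fderiv ℝ F z (F z u) v = fderiv ℝ F z (F z v) u

/-- The velocity `t ↦ F(γ t) x` prescribed, at `p = (x, γ)`, by the differential equation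
`γ' = F(γ) x`. -/
def velocity (F : C(E, H →L[ℝ] E)) (p : H × C(unitInterval, E)) : C(unitInterval, E) :=
  pointwiseApply unitInterval H E (F.comp p.2) (ContinuousLinearMap.const ℝ unitInterval p.1)

/-- The map `(x, γ) ↦ (x, γ - ∫ F(γ) x)`. It sends `(x, γ)` to `(x, y)`, with `y` a constant path,
exactly when `γ' = F(γ) x` and `γ 0 = y`. -/
def odeDefect (F : C(E, H →L[ℝ] E)) (p : H × C(unitInterval, E)) : H × C(unitInterval, E) :=
  (p.1, p.2 - primitive E (velocity F p))

variable {F : C(E, H →L[ℝ] E)}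

@[simp]
lemma velocity_apply (p : H × C(unitInterval, E)) (t : unitInterval) :
    velocity F p t = F (p.2 t) p.1 := rfl

lemma contDiff_velocity (hF : ContDiff ℝ ∞ F) : ContDiff ℝ ∞ (velocity F) :=
  ((pointwiseApply unitInterval H E).contDiff.comp
      ((contDiff_postcomp F hF).comp contDiff_snd)).clm_apply
    ((ContinuousLinearMap.const (M := H) ℝ unitInterval).contDiff.comp contDiff_fst)

lemma fderiv_velocity_apply (hF : ContDiff ℝ ∞ F) (p q : H × C(unitInterval, E))
    (t : unitInterval) :
    fderiv ℝ (velocity F) p q t = F (p.2 t) q.1 + fderiv ℝ F (p.2 t) (q.2 t) p.1 := by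
  have hF' : ∀ z, HasFDerivAt F (fderiv ℝ F z) z := fun z ↦
    (hF.differentiable (by simp) z).hasFDerivAt
  have hpost := (hasFDerivAt_postcomp F ⟨fderiv ℝ F, hF.continuous_fderiv (by simp)⟩ hF' p.2).comp
    p hasFDerivAt_snd
  have hconst := (ContinuousLinearMap.const (M := H) ℝ unitInterval).hasFDerivAt.comp p
    (hasFDerivAt_fst (𝕜 := ℝ))
  have hvelocity : HasFDerivAt (velocity F) _ p :=
    ((pointwiseApply unitInterval H E).hasFDerivAt.comp p hpost).clm_apply hconst
  rw [hvelocity.fderiv]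
  rfl

lemma odeDefect_zero (γ : C(unitInterval, E)) : odeDefect F (0, γ) = (0, γ) := by
  have : velocity F (0, γ) = 0 := by ext; simp
  simp [odeDefect, this]

lemma eq_of_odeDefect_eq_zero_mk {p : H × C(unitInterval, E)} {γ : C(unitInterval, E)}
    (hp : odeDefect F p = (0, γ)) : p = (0, γ) := by
  obtain ⟨x, η⟩ := p
  obtain rfl : x = 0 := congr($(hp).1)
  rwa [odeDefect_zero] at hp

lemma contDiff_odeDefect (hF : ContDiff ℝ ∞ F) : ContDiff ℝ ∞ (odeDefect F) :=
  contDiff_fst.prodMk (contDiff_snd.sub ((primitive E).contDiff.comp (contDiff_velocity hF)))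

lemma hasFDerivAt_odeDefect (hF : ContDiff ℝ ∞ F) (p : H × C(unitInterval, E)) :
    HasFDerivAt (odeDefect F) ((ContinuousLinearMap.fst ℝ _ _).prod
      (ContinuousLinearMap.snd ℝ _ _ - primitive E ∘L fderiv ℝ (velocity F) p)) p :=
  hasFDerivAt_fst.prodMk (hasFDerivAt_snd.sub ((primitive E).hasFDerivAt.comp p
    ((contDiff_velocity hF).differentiable (by simp) p).hasFDerivAt))

lemma hasFDerivAt_odeDefect_zero (hF : ContDiff ℝ ∞ F) (γ : C(unitInterval, E)) :
    ∃ A : (H × C(unitInterval, E)) ≃L[ℝ] H × C(unitInterval, E),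
      HasFDerivAt (odeDefect F) (A : _ →L[ℝ] _) (0, γ) := by
  refine ⟨(ContinuousLinearEquiv.refl ℝ H).skewProd (ContinuousLinearEquiv.refl ℝ _)
    (-(primitive E ∘L fderiv ℝ (velocity F) (0, γ) ∘L ContinuousLinearMap.inl ℝ _ _)), ?_⟩
  convert hasFDerivAt_odeDefect hF (0, γ) using 1
  have hpath (q : H × C(unitInterval, E)) :
      fderiv ℝ (velocity F) (0, γ) q = fderiv ℝ (velocity F) (0, γ) (q.1, 0) := by
    ext t
    simp [fderiv_velocity_apply hF]
  refine ContinuousLinearMap.ext fun q ↦ ?_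
  simp [hpath q, sub_eq_add_neg]

variable [CompleteSpace E]

/-- Commutation is what makes `t ↦ t F(γ t) u` a solution of the linearised equation. -/
lemma exists_path_eq_primitive_fderiv_velocity (hF : ContDiff ℝ ∞ F)
    {x : H} {y : E} {γ : C(unitInterval, E)}
    (hγ : γ = .const _ y + primitive E (velocity F (x, γ)))
    (hcomm : ∀ t, CommutesAt F (γ t)) (u : H) :
    ∃ β : C(unitInterval, E), β 1 = F (γ 1) u ∧
      β = primitive E (fderiv ℝ (velocity F) (x, γ) (u, β)) := by
  let β : C(unitInterval, E) := ⟨fun t ↦ (t : ℝ) • F (γ t) u, by fun_prop⟩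
  refine ⟨β, by simp [β], ?_⟩
  obtain ⟨c, hc, hcprim⟩ := exists_hasDerivAt_primitive (velocity F (x, γ))
  have hγc (t : unitInterval) : γ t = y + c t := by
    rw [hcprim]; exact congr($hγ t)
  have hderiv (t : unitInterval) : HasDerivAt (fun s : ℝ ↦ s • F (y + c s) u)
      (fderiv ℝ (velocity F) (x, γ) (u, β) t) t := by
    have hcurve : HasDerivAt (fun s ↦ F (y + c s)) (fderiv ℝ F (γ t) (F (γ t) x)) t := by
      have hFt : HasFDerivAt F (fderiv ℝ F (γ t)) (y + c t) := by
        rw [← hγc]; exact (hF.differentiable (by simp) _).hasFDerivAt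
      exact hFt.comp_hasDerivAt _ ((hc t).const_add y)
    refine ((hasDerivAt_id (t : ℝ)).smul (hcurve.clm_apply (hasDerivAt_const _ u))).congr_deriv ?_
    rw [fderiv_velocity_apply hF]
    simp [β, ← hγc, hcomm t x u, add_comm]
  ext t
  rw [primitive_eq_sub hderiv]
  simp [β, hγc]

lemma symm_apply_one_of_odeDefect_eq_const (hF : ContDiff ℝ ∞ F) {p : H × C(unitInterval, E)}
    {y : E} (hp : (odeDefect F p).2 = .const _ y) (hcomm : ∀ t, CommutesAt F (p.2 t))
    {A : (H × C(unitInterval, E)) ≃L[ℝ] H × C(unitInterval, E)}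
    (hA : HasFDerivAt (odeDefect F) (A : _ →L[ℝ] _) p) (u : H) :
    (A.symm (u, 0)).2 1 = F (p.2 1) u := by
  obtain ⟨β, hβ, hβsol⟩ :=
    exists_path_eq_primitive_fderiv_velocity hF (sub_eq_iff_eq_add.1 hp) hcomm u
  have hAβ : A (u, β) = (u, 0) := by
    rw [← A.coe_coe, hA.unique (hasFDerivAt_odeDefect hF _)]
    refine Prod.ext rfl ?_
    simpa [sub_eq_zero] using hβsol
  rw [← hAβ, A.symm_apply_apply, hβ]

variable [CompleteSpace H]

theorem exists_flow_of_commutesAt (hF : ContDiff ℝ ∞ F) {z₀ : E}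
    (hcomm : ∀ᶠ z in 𝓝 z₀, CommutesAt F z) :
    ∃ (U : Set (H × E)) (Φ : H × E → E), IsOpen U ∧ (0, z₀) ∈ U ∧ ContDiffOn ℝ ∞ Φ U ∧
      (∀ y, (0, y) ∈ U → Φ (0, y) = y) ∧
      ∀ p ∈ U, ∃ Φ' : H × E →L[ℝ] E, HasFDerivAt Φ Φ' p ∧ ∀ u, Φ' (u, 0) = F (Φ p) u := by
  obtain ⟨V, hVcomm, hV, hz₀⟩ := eventually_nhds_iff.1 hcomm
  obtain ⟨A₀, hA₀⟩ := hasFDerivAt_odeDefect_zero hF (.const _ z₀)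
  have hpaths : IsOpen {p : H × C(unitInterval, E) | MapsTo p.2 univ V} :=
    (ContinuousMap.isOpen_setOfPred_mapsTo isCompact_univ hV).preimage continuous_snd
  obtain ⟨e, he₀, hesource, hef, hesymm, hederiv⟩ :=
    exists_openPartialHomeomorph_of_hasFDerivAt_equiv (by simp) hpaths
      (contDiff_odeDefect hF).contDiffOn (fun _ _ ↦ hz₀) hA₀
  let j : H × E →L[ℝ] H × C(unitInterval, E) :=
    (ContinuousLinearMap.id ℝ H).prodMap (ContinuousLinearMap.const ℝ unitInterval)
  let ev : H × C(unitInterval, E) →L[ℝ] E :=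
    ContinuousMap.evalCLM ℝ (1 : unitInterval) ∘L ContinuousLinearMap.snd ℝ _ _
  have hsol (p : H × E) (hp : p ∈ j ⁻¹' e.target) : odeDefect F (e.symm (j p)) = j p := by
    rw [← hef, e.right_inv hp]
  refine ⟨j ⁻¹' e.target, ev ∘ e.symm ∘ j, e.open_target.preimage j.continuous, ?_,
    ev.contDiff.comp_contDiffOn (hesymm.comp j.contDiff.contDiffOn fun _ h ↦ h),
    fun y hy ↦ ?_, fun p hp ↦ ?_⟩
  · have := e.map_source he₀
    rwa [hef, odeDefect_zero] at this
  · exact congr(ev $(eq_of_odeDefect_eq_zero_mk (hsol _ hy)))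
  · obtain ⟨A, hA⟩ := hederiv _ (e.map_target hp)
    refine ⟨_, ev.hasFDerivAt.comp p ((e.hasFDerivAt_symm hp (hef ▸ hA)).comp p j.hasFDerivAt),
      fun u ↦ ?_⟩
    exact symm_apply_one_of_odeDefect_eq_const hF congr($(hsol p hp).2)
      (fun t ↦ hVcomm _ (hesource (e.map_target hp) trivial)) hA u

end CommutingFrame

section Straightening

universe u

variable {H E : Type u} [NormedAddCommGroup H] [NormedSpace ℝ H]
  [NormedAddCommGroup E] [NormedSpace ℝ E]

lemma exists_contDiff_eventuallyEq {G : Type*} [NormedAddCommGroup G] [NormedSpace ℝ G]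
    [HasContDiffBump E] {f : E → G} {U : Set E} (hU : IsOpen U) (hf : ContDiffOn ℝ ∞ f U)
    {a : E} (ha : a ∈ U) : ∃ g : E → G, ContDiff ℝ ∞ g ∧ g =ᶠ[𝓝 a] f := by
  obtain ⟨δ, hδ, hball⟩ := Metric.nhds_basis_closedBall.mem_iff.1 (hU.mem_nhds ha)
  let ρ : ContDiffBump a := ⟨δ / 2, δ, by positivity, by linarith⟩
  refine ⟨fun x ↦ ρ x • f x, contMDiff_iff_contDiff.1 (contMDiff_of_tsupport fun x hx ↦ ?_), ?_⟩
  · have hxU : x ∈ U := hball (ρ.tsupport_eq ▸ tsupport_smul_subset_left _ _ hx)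
    exact (ρ.contDiffAt.smul ((hf x hxU).contDiffAt (hU.mem_nhds hxU))).contMDiffAt
  · filter_upwards [ρ.eventuallyEq_one] with x hx
    simp [hx]

lemma lieBracket_apply_frame {F : E → H →L[ℝ] E} {z : E} (hF : DifferentiableAt ℝ F z) (u v : H) :
    VectorField.lieBracket ℝ (F · u) (F · v) z =
      fderiv ℝ F z (F z u) v - fderiv ℝ F z (F z v) u := by
  simp [VectorField.lieBracket, fderiv_clm_apply hF (differentiableAt_const _)]

/-- The projection `P` kills brackets of the fields `F u`, whose projections are constant, and is
injective on the range of `F`. -/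
lemma commutesAt_of_lieBracket_mem_range {F : E → H →L[ℝ] E} {P : E →L[ℝ] H} {z : E}
    (hF : DifferentiableAt ℝ F z) (hP : ∀ᶠ w in 𝓝 z, P ∘L F w = .id ℝ H)
    (hbracket : ∀ u v, VectorField.lieBracket ℝ (F · u) (F · v) z ∈ (F z).range) :
    CommutesAt F z := by
  intro u v
  have hconst (w : E) : P ∘L fderiv ℝ F z w = 0 := by
    have hcomp := ((ContinuousLinearMap.compL ℝ H E H P).hasFDerivAt.comp z hF.hasFDerivAt).fderiv
    have hzero : fderiv ℝ (ContinuousLinearMap.compL ℝ H E H P ∘ F) z = 0 := by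
      have : ContinuousLinearMap.compL ℝ H E H P ∘ F =ᶠ[𝓝 z] fun _ ↦ .id ℝ H := hP
      rw [this.fderiv_eq, fderiv_fun_const]
      rfl
    exact congr($(hcomp.symm.trans hzero) w)
  obtain ⟨a, ha⟩ := hbracket u v
  rw [lieBracket_apply_frame hF] at ha
  have hPF : P (F z a) = a := congr($(hP.self_of_nhds) a)
  have hPbracket : P (F z a) = 0 := by
    have hPderiv (w : E) (h : H) : P (fderiv ℝ F z w h) = 0 := congr($(hconst w) h)
    rw [ContinuousLinearMap.coe_coe] at ha
    rw [ha, map_sub, hPderiv, hPderiv, sub_zero]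
  rw [← sub_eq_zero, ← ha, ← hPF, hPbracket]
  simp

lemma exists_frame_section_of_projection [CompleteSpace H] {ξ : E → H →L[ℝ] E} {U : Set E}
    (hU : IsOpen U) (hξ : ContDiffOn ℝ ∞ ξ U) {z₀ : E} (hz₀ : z₀ ∈ U) {P : E →L[ℝ] H}
    (hP : P ∘L ξ z₀ = .id ℝ H) :
    ∃ (V : Set E) (F : E → H →L[ℝ] E), IsOpen V ∧ z₀ ∈ V ∧ V ⊆ U ∧ ContDiffOn ℝ ∞ F V ∧
      ∀ z ∈ V, P ∘L F z = .id ℝ H ∧ (F z).range = (ξ z).range := by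
  have hsmooth : ContDiffOn ℝ ∞ (fun z ↦ P ∘L ξ z) U := contDiffOn_const.clm_comp hξ
  refine ⟨U ∩ (fun z ↦ P ∘L ξ z) ⁻¹' range ((↑) : (H ≃L[ℝ] H) → H →L[ℝ] H),
    fun z ↦ ξ z ∘L (P ∘L ξ z).inverse,
    hsmooth.continuousOn.isOpen_inter_preimage hU ContinuousLinearEquiv.isOpen,
    ⟨hz₀, .refl ℝ H, hP.symm⟩, inter_subset_left, ?_, ?_⟩
  · rintro z ⟨hz, A, hA⟩
    have hinv : ContDiffAt ℝ ∞ ContinuousLinearMap.inverse (P ∘L ξ z) :=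
      (show (A : H →L[ℝ] H) = P ∘L ξ z from hA) ▸ contDiffAt_map_inverse A
    exact ((hξ z hz).mono inter_subset_left).clm_comp
      (hinv.comp_contDiffWithinAt (f := fun z ↦ P ∘L ξ z) z
        ((hsmooth z hz).mono inter_subset_left))
  · rintro z ⟨-, hA⟩
    have hinv : (P ∘L ξ z).IsInvertible := hA
    refine ⟨by rw [← ContinuousLinearMap.comp_assoc, hinv.self_comp_inverse], le_antisymm ?_ ?_⟩
    · rintro - ⟨u, rfl⟩
      exact ⟨_, rfl⟩
    · rintro - ⟨u, rfl⟩
      exact ⟨(P ∘L ξ z) u, congr(ξ z $(hinv.inverse_apply_self u))⟩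

/-- Flow box coordinates: from the point of the transversal `z₀ + ker P` with coordinate
`w - s (P w)`, follow the flow `Φ` for the multi-time `P w`. -/
def flowBox (Φ : H × E → E) (P : E →L[ℝ] H) (s : H →L[ℝ] E) (z₀ w : E) : E :=
  Φ (P w, z₀ + (w - s (P w)))

section FlowBox

variable {Φ : H × E → E} {P : E →L[ℝ] H} {s : H →L[ℝ] E} {z₀ : E} {Φ' : H × E →L[ℝ] E}

lemma flowBox_zero : flowBox Φ P s z₀ 0 = Φ (0, z₀) := by simp [flowBox]

lemma hasFDerivAt_flowBox {w : E} (hΦ : HasFDerivAt Φ Φ' (P w, z₀ + (w - s (P w)))) :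
    HasFDerivAt (flowBox Φ P s z₀) (Φ' ∘L P.prod (.id ℝ E - s ∘L P)) w :=
  hΦ.comp w (P.hasFDerivAt.prodMk ((ContinuousLinearMap.id ℝ E - s ∘L P).hasFDerivAt.const_add z₀))

lemma hasFDerivAt_flowBox_zero (hΦ : HasFDerivAt Φ Φ' (0, z₀))
    (hΦzero : ∀ᶠ y in 𝓝 z₀, Φ (0, y) = y) (hΦ' : ∀ u, Φ' (u, 0) = s u) :
    HasFDerivAt (flowBox Φ P s z₀) (ContinuousLinearMap.id ℝ E) 0 := by
  have hΦ'right (k : E) : Φ' (0, k) = k :=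
    congr($((hΦ.comp z₀ (hasFDerivAt_prodMk_right (0 : H) z₀)).unique
      ((hasFDerivAt_id z₀).congr_of_eventuallyEq hΦzero)) k)
  refine (hasFDerivAt_flowBox (w := 0) (by simpa using hΦ)).congr_fderiv ?_
  ext w
  have hsplit : P.prod (.id ℝ E - s ∘L P) w = (P w, 0) + (0, w - s (P w)) := by simp
  rw [ContinuousLinearMap.comp_apply, hsplit, map_add, hΦ', hΦ'right]
  simp

lemma comp_prod_apply_section (hs : P ∘L s = .id ℝ H) (u : H) :
    (Φ' ∘L P.prod (.id ℝ E - s ∘L P)) (s u) = Φ' (u, 0) := by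
  have : P (s u) = u := congr($hs u)
  simp [this]

end FlowBox

lemma exists_straightening_of_commutesAt [CompleteSpace E] [CompleteSpace H]
    {F : E → H →L[ℝ] E} (hF : ContDiff ℝ ∞ F) {z₀ : E} {P : E →L[ℝ] H}
    (hP : P ∘L F z₀ = .id ℝ H) {U : Set E} (hU : U ∈ 𝓝 z₀)
    (hcomm : ∀ᶠ z in 𝓝 z₀, CommutesAt F z) :
    ∃ e : OpenPartialHomeomorph E E, z₀ ∈ e.source ∧ e.source ⊆ U ∧ ContDiffOn ℝ ∞ e e.source ∧
      ContDiffOn ℝ ∞ e.symm e.target ∧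
      ∀ z ∈ e.source, ∃ A : E ≃L[ℝ] E, HasFDerivAt e (A : E →L[ℝ] E) z ∧ A ∘L F z = F z₀ := by
  obtain ⟨O, Φ, hO, hz₀O, hΦ, hΦzero, hΦderiv⟩ :=
    exists_flow_of_commutesAt (F := ⟨F, hF.continuous⟩) hF hcomm
  set Ψ := flowBox Φ P (F z₀) z₀
  have hflow : ContDiff ℝ ∞ fun w ↦ (P w, z₀ + (w - F z₀ (P w))) := by fun_prop
  set O' := (fun w ↦ (P w, z₀ + (w - F z₀ (P w)))) ⁻¹' O
  have hO' : IsOpen O' := hO.preimage hflow.continuous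
  have h0 : (0 : E) ∈ O' := by simpa [O'] using hz₀O
  have hΨ : ContDiffOn ℝ ∞ Ψ O' := hΦ.comp hflow.contDiffOn fun _ h ↦ h
  have hΨzero : Ψ 0 = z₀ := flowBox_zero.trans (hΦzero z₀ hz₀O)
  have hΨderiv : HasFDerivAt Ψ (ContinuousLinearMap.id ℝ E) 0 := by
    obtain ⟨Φ', hΦ', hΦ'F⟩ := hΦderiv _ hz₀O
    refine hasFDerivAt_flowBox_zero hΦ' ?_ fun u ↦ by
      rw [hΦ'F, hΦzero z₀ hz₀O, ContinuousMap.coe_mk]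
    filter_upwards [(hO.preimage (Continuous.prodMk_right (0 : H))).mem_nhds hz₀O]
      with y hy using hΦzero y hy
  obtain ⟨V, hVU, hV, hz₀V⟩ := mem_nhds_iff.1 hU
  obtain ⟨e, he0, hesource, heΨ, hesymm, hederiv⟩ :=
    exists_openPartialHomeomorph_of_hasFDerivAt_equiv (by simp)
      (hΨ.continuousOn.isOpen_inter_preimage hO' hV) (hΨ.mono inter_subset_left)
      (show (0 : E) ∈ O' ∩ Ψ ⁻¹' V from ⟨h0, by rwa [mem_preimage, hΨzero]⟩)
      (f' := .refl ℝ E) hΨderiv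
  have hright (z : E) (hz : z ∈ e.target) : Ψ (e.symm z) = z := heΨ ▸ e.right_inv hz
  refine ⟨e.symm, ?_, fun z hz ↦ ?_, hesymm, ?_, fun z hz ↦ ?_⟩
  · have := e.map_source he0
    rwa [heΨ, hΨzero] at this
  · exact hVU (hright z hz ▸ (hesource (e.map_target hz)).2)
  · simpa [heΨ] using hΨ.mono (hesource.trans inter_subset_left)
  · obtain ⟨A, hA⟩ := hederiv _ (e.map_target hz)
    obtain ⟨Φ', hΦ', hΦ'F⟩ := hΦderiv _ (hesource (e.map_target hz)).1
    refine ⟨A.symm, e.hasFDerivAt_symm hz (heΨ ▸ hA), ContinuousLinearMap.ext fun u ↦ ?_⟩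
    have hΦz : Φ (P (e.symm z), z₀ + (e.symm z - F z₀ (P (e.symm z)))) = z := hright z hz
    have hAF : A (F z₀ u) = F z u := by
      rw [← A.coe_coe, hA.unique (hasFDerivAt_flowBox hΦ'), comp_prod_apply_section hP, hΦ'F, hΦz,
        ContinuousMap.coe_mk]
    exact A.symm_apply_eq.2 hAF.symm

lemma CommutesAt.congr {F G : E → H →L[ℝ] E} {z : E} (hF : CommutesAt F z) (hGF : G =ᶠ[𝓝 z] F) :
    CommutesAt G z := fun u v ↦ by
  rw [hGF.fderiv_eq, hGF.self_of_nhds]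
  exact hF u v

/-- Involutivity on `U` of a field of subspaces of a normed space. Sections over arbitrary open
subsets of `U` are allowed, which makes it a local condition. -/
def InvolutiveOn (D : E → Submodule ℝ E) (U : Set E) : Prop :=
  ∀ (O : Set E) (X Y : E → E), IsOpen O → O ⊆ U → ContDiffOn ℝ ∞ X O → ContDiffOn ℝ ∞ Y O →
    (∀ z ∈ O, X z ∈ D z) → (∀ z ∈ O, Y z ∈ D z) → ∀ z ∈ O, VectorField.lieBracket ℝ X Y z ∈ D z

lemma InvolutiveOn.congr {D D' : E → Submodule ℝ E} {U : Set E} (hD : InvolutiveOn D U)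
    (h : EqOn D' D U) : InvolutiveOn D' U := fun O X Y hO hOU hX hY hXD hYD z hz ↦
  h (hOU hz) ▸ hD O X Y hO hOU hX hY (fun y hy ↦ h (hOU hy) ▸ hXD y hy)
    (fun y hy ↦ h (hOU hy) ▸ hYD y hy) z hz

lemma InvolutiveOn.mono {D : E → Submodule ℝ E} {U U' : Set E} (hD : InvolutiveOn D U)
    (h : U' ⊆ U) : InvolutiveOn D U' := fun O X Y hO hOU ↦ hD O X Y hO (hOU.trans h)

variable [FiniteDimensional ℝ E] [FiniteDimensional ℝ H]

lemma exists_commuting_frame_of_involutive {ξ : E → H →L[ℝ] E} {U : Set E} (hU : IsOpen U)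
    (hξ : ContDiffOn ℝ ∞ ξ U) {z₀ : E} (hz₀ : z₀ ∈ U) (hinj : Function.Injective (ξ z₀))
    (hinv : InvolutiveOn (fun z ↦ (ξ z).range) U) :
    ∃ (F : E → H →L[ℝ] E) (P : E →L[ℝ] H), ContDiff ℝ ∞ F ∧ P ∘L F z₀ = .id ℝ H ∧
      ∀ᶠ z in 𝓝 z₀, CommutesAt F z ∧ (F z).range = (ξ z).range := by
  obtain ⟨Q, hQ⟩ := (ξ z₀ : H →ₗ[ℝ] E).exists_leftInverse_of_injective
    (LinearMap.ker_eq_bot.2 hinj)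
  let P : E →L[ℝ] H := LinearMap.toContinuousLinearMap Q
  obtain ⟨V, F, hV, hz₀V, hVU, hF, hFP⟩ :=
    exists_frame_section_of_projection hU hξ hz₀ (P := P) (ContinuousLinearMap.coe_injective hQ)
  have hFcomm (z : E) (hz : z ∈ V) : CommutesAt F z := by
    have hFrange (u : H) (y : E) (hy : y ∈ V) : F y u ∈ (ξ y).range := (hFP y hy).2 ▸ ⟨u, rfl⟩
    refine commutesAt_of_lieBracket_mem_range (P := P)
      (((hF z hz).contDiffAt (hV.mem_nhds hz)).differentiableAt (by simp)) ?_ fun u v ↦ ?_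
    · filter_upwards [hV.mem_nhds hz] with w hw using (hFP w hw).1
    · rw [(hFP z hz).2]
      exact hinv V (F · u) (F · v) hV hVU (hF.clm_apply contDiffOn_const)
        (hF.clm_apply contDiffOn_const) (hFrange u) (hFrange v) z hz
  obtain ⟨G, hG, hGF⟩ := exists_contDiff_eventuallyEq hV hF hz₀V
  refine ⟨G, P, hG, by rw [hGF.self_of_nhds, (hFP z₀ hz₀V).1], ?_⟩
  filter_upwards [hGF.eventuallyEq_nhds, hV.mem_nhds hz₀V] with z hz hzV
  exact ⟨(hFcomm z hzV).congr hz, hz.self_of_nhds ▸ (hFP z hzV).2⟩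

theorem exists_straightening_of_involutive {ξ : E → H →L[ℝ] E} {U : Set E} (hU : IsOpen U)
    (hξ : ContDiffOn ℝ ∞ ξ U) {z₀ : E} (hz₀ : z₀ ∈ U) (hinj : Function.Injective (ξ z₀))
    (hinv : InvolutiveOn (fun z ↦ (ξ z).range) U) :
    ∃ e : OpenPartialHomeomorph E E, z₀ ∈ e.source ∧ e.source ⊆ U ∧ ContDiffOn ℝ ∞ e e.source ∧
      ContDiffOn ℝ ∞ e.symm e.target ∧ ∀ z ∈ e.source, ∀ w,
        w ∈ (ξ z).range ↔ fderiv ℝ e z w ∈ (ξ z₀).range := by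
  obtain ⟨F, P, hF, hP, hFξ⟩ := exists_commuting_frame_of_involutive hU hξ hz₀ hinj hinv
  obtain ⟨e, hz₀e, hesource, he, hesymm, hederiv⟩ := exists_straightening_of_commutesAt hF hP
    (hFξ.and (hU.mem_nhds hz₀)) (hFξ.mono fun _ h ↦ h.1)
  refine ⟨e, hz₀e, fun z hz ↦ (hesource hz).2, he, hesymm, fun z hz w ↦ ?_⟩
  obtain ⟨A, hA, hAF⟩ := hederiv z hz
  rw [hA.fderiv, ← (hesource hz).1.2, ← hFξ.self_of_nhds.2, ← hAF]
  constructor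
  · rintro ⟨u, rfl⟩
    exact ⟨u, rfl⟩
  · rintro ⟨u, hu⟩
    exact ⟨u, A.injective hu⟩

end Straightening

section FrameStraightening

universe u

lemma exists_linearEquiv_map_eq_of_finrank_eq {K V : Type*} [Field K] [AddCommGroup V] [Module K V]
    [FiniteDimensional K V] {S T : Submodule K V}
    (h : Module.finrank K S = Module.finrank K T) : ∃ q : V ≃ₗ[K] V, S.map q.toLinearMap = T := by
  obtain ⟨S', hS⟩ := S.exists_isCompl
  obtain ⟨T', hT⟩ := T.exists_isCompl
  have h' : Module.finrank K S' = Module.finrank K T' := by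
    have hSV := Submodule.finrank_add_eq_of_isCompl hS
    have hTV := Submodule.finrank_add_eq_of_isCompl hT
    omega
  let q : V ≃ₗ[K] V := (Submodule.prodEquivOfIsCompl S S' hS).symm ≪≫ₗ
    (LinearEquiv.ofFinrankEq S T h).prodCongr (LinearEquiv.ofFinrankEq S' T' h') ≪≫ₗ
    Submodule.prodEquivOfIsCompl T T' hT
  have hq (s : S) : q s = LinearEquiv.ofFinrankEq S T h s := by simp [q]
  refine ⟨q, Submodule.eq_of_le_of_finrank_eq ?_ ((LinearEquiv.finrank_map_eq q S).trans h)⟩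
  rintro _ ⟨s, hs, rfl⟩
  exact hq ⟨s, hs⟩ ▸ Subtype.property _

theorem exists_straightening_of_frame {κ E : Type u} [Fintype κ] [NormedAddCommGroup E]
    [NormedSpace ℝ E] [FiniteDimensional ℝ E] {D : E → Submodule ℝ E} {U : Set E} (hU : IsOpen U)
    {V : κ → E → E} (hV : ∀ i, ContDiffOn ℝ ∞ (V i) U)
    (hspan : ∀ z ∈ U, Submodule.span ℝ (range fun i ↦ V i z) = D z) {z₀ : E} (hz₀ : z₀ ∈ U)
    (hli : LinearIndependent ℝ fun i ↦ V i z₀)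
    (hinv : InvolutiveOn D U) {T : Submodule ℝ E}
    (hT : Module.finrank ℝ T = Fintype.card κ) :
    ∃ e : OpenPartialHomeomorph E E, z₀ ∈ e.source ∧ e.source ⊆ U ∧ ContDiffOn ℝ ∞ e e.source ∧
      ContDiffOn ℝ ∞ e.symm e.target ∧ ∀ z ∈ e.source, ∀ w, w ∈ D z ↔ fderiv ℝ e z w ∈ T := by
  let ξ (z : E) : (κ → ℝ) →L[ℝ] E :=
    LinearMap.toContinuousLinearMap (Fintype.linearCombination ℝ fun i ↦ V i z)
  have hξ_apply (z : E) (u : κ → ℝ) : ξ z u = ∑ i, u i • V i z :=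
    Fintype.linearCombination_apply ℝ _ u
  have hξ : ContDiffOn ℝ ∞ ξ U := by
    refine contDiffOn_clm_apply.2 fun u ↦ ?_
    simp only [hξ_apply]
    exact ContDiffOn.sum fun i _ ↦ contDiffOn_const.smul (hV i)
  have hrange : ∀ z ∈ U, (ξ z).range = D z := fun z hz ↦
    (Fintype.range_linearCombination ℝ _).trans (hspan z hz)
  obtain ⟨e, hz₀e, heU, he, he', hflat⟩ := exists_straightening_of_involutive hU hξ hz₀
    (linearIndependent_iff_injective_fintypeLinearCombination.1 hli)
    (hinv.congr hrange)
  have hfinrank : Module.finrank ℝ (ξ z₀).range = Module.finrank ℝ T := by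
    rw [hrange z₀ hz₀, ← hspan z₀ hz₀, finrank_span_eq_card hli, hT]
  obtain ⟨q, hq⟩ := exists_linearEquiv_map_eq_of_finrank_eq hfinrank
  let Q := q.toContinuousLinearEquiv
  refine ⟨e.trans Q.toHomeomorph.toOpenPartialHomeomorph, ?_, ?_, ?_, ?_, ?_⟩
  · simpa using hz₀e
  · simpa using heU
  · simpa using Q.contDiff.comp_contDiffOn he
  · simpa using he'.comp (s := Q.symm ⁻¹' e.target) Q.symm.contDiff.contDiffOn fun _ h ↦ h
  · intro z hz w
    have hze : z ∈ e.source := by simpa using hz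
    have hQe : fderiv ℝ (e.trans Q.toHomeomorph.toOpenPartialHomeomorph) z w =
        q (fderiv ℝ e z w) :=
      congr($(Q.comp_fderiv) w)
    rw [← hrange z (heU hze), hflat z hze, hQe, ← hq]
    exact (q.injective.mem_set_image).symm

end FrameStraightening

section Charts

variable {n : ℕ} {N : Type*} [TopologicalSpace N] [ChartedSpace (EuclideanSpace ℝ (Fin n)) N]
  {c : OpenPartialHomeomorph N (EuclideanSpace ℝ (Fin n))}

lemma mdifferentiable_of_mem_maximalAtlas (hc : c ∈ IsManifold.maximalAtlas (𝓡 n) ∞ N) :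
    c.MDifferentiable (𝓡 n) (𝓡 n) :=
  ⟨(contMDiffOn_of_mem_maximalAtlas hc).mdifferentiableOn (by simp),
    (contMDiffOn_symm_of_mem_maximalAtlas hc).mdifferentiableOn (by simp)⟩

lemma isInvertible_mfderiv_of_mem_maximalAtlas (hc : c ∈ IsManifold.maximalAtlas (𝓡 n) ∞ N)
    {x : N} (hx : x ∈ c.source) : (mfderiv (𝓡 n) (𝓡 n) c x).IsInvertible :=
  ⟨(mdifferentiable_of_mem_maximalAtlas hc).mfderiv hx, rfl⟩

lemma isInvertible_mfderiv_symm_of_mem_maximalAtlas (hc : c ∈ IsManifold.maximalAtlas (𝓡 n) ∞ N)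
    {z : EuclideanSpace ℝ (Fin n)} (hz : z ∈ c.target) :
    (mfderiv (𝓡 n) (𝓡 n) c.symm z).IsInvertible :=
  ⟨(mdifferentiable_of_mem_maximalAtlas hc).symm.mfderiv hz, rfl⟩

/-- The expression in the chart `c` of a vector field on `N`. -/
def coordField (c : OpenPartialHomeomorph N (EuclideanSpace ℝ (Fin n)))
    (X : ∀ x : N, TangentSpace (𝓡 n) x) : EuclideanSpace ℝ (Fin n) → EuclideanSpace ℝ (Fin n) :=
  VectorField.mpullback (𝓡 n) (𝓡 n) c.symm X

/-- The expression in the chart `c` of a field of subspaces of the tangent spaces of `N`. -/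
def coordDistribution (c : OpenPartialHomeomorph N (EuclideanSpace ℝ (Fin n)))
    (D : ∀ x : N, Submodule ℝ (TangentSpace (𝓡 n) x)) (z : EuclideanSpace ℝ (Fin n)) :
    Submodule ℝ (EuclideanSpace ℝ (Fin n)) :=
  (D (c.symm z)).comap (mfderiv (𝓡 n) (𝓡 n) c.symm z).toLinearMap

lemma exists_equiv_mfderiv_symm (hc : c ∈ IsManifold.maximalAtlas (𝓡 n) ∞ N)
    {z : EuclideanSpace ℝ (Fin n)} (hz : z ∈ c.target) :
    ∃ A : EuclideanSpace ℝ (Fin n) ≃L[ℝ] TangentSpace (𝓡 n) (c.symm z),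
      (∀ v, A v = mfderiv (𝓡 n) (𝓡 n) c.symm z v) ∧
      ∀ X : (∀ x : N, TangentSpace (𝓡 n) x), A (coordField c X z) = X (c.symm z) := by
  obtain ⟨A, hA⟩ := isInvertible_mfderiv_symm_of_mem_maximalAtlas hc hz
  refine ⟨A, fun v ↦ congr($hA v), fun X ↦ ?_⟩
  exact A.symm_apply_eq.1 (by rw [coordField, VectorField.mpullback_apply, ← hA,
    ContinuousLinearMap.inverse_equiv]; rfl) |>.symm

lemma coordField_apply (hc : c ∈ IsManifold.maximalAtlas (𝓡 n) ∞ N) {x : N} (hx : x ∈ c.source)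
    (X : ∀ x : N, TangentSpace (𝓡 n) x) :
    coordField c X (c x) = mfderiv (𝓡 n) (𝓡 n) c x (X x) := by
  obtain ⟨A, hA, hAX⟩ := exists_equiv_mfderiv_symm hc (c.map_source hx)
  let X' : N → EuclideanSpace ℝ (Fin n) := X
  refine A.injective ((hAX X).trans ?_)
  exact (congrArg X' (c.left_inv hx)).trans ((hA _).trans
    congr($((mdifferentiable_of_mem_maximalAtlas hc).symm_comp_deriv hx) (X x))).symm

lemma coordField_mpullback (hc : c ∈ IsManifold.maximalAtlas (𝓡 n) ∞ N)
    {z : EuclideanSpace ℝ (Fin n)} (hz : z ∈ c.target)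
    (V : EuclideanSpace ℝ (Fin n) → EuclideanSpace ℝ (Fin n)) :
    coordField c (VectorField.mpullback (𝓡 n) (𝓡 n) c V) z = V z := by
  obtain ⟨A, hA, hAX⟩ := exists_equiv_mfderiv_symm hc hz
  refine A.injective ((hAX _).trans ?_)
  refine (isInvertible_mfderiv_of_mem_maximalAtlas hc (c.map_target hz)).inverse_apply_eq.2 ?_
  rw [hA]
  exact (congrArg V (c.right_inv hz)).trans
    congr($((mdifferentiable_of_mem_maximalAtlas hc).comp_symm_deriv hz) (V z)).symm

lemma coordField_mem_iff (hc : c ∈ IsManifold.maximalAtlas (𝓡 n) ∞ N)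
    {z : EuclideanSpace ℝ (Fin n)} (hz : z ∈ c.target) {X : ∀ x : N, TangentSpace (𝓡 n) x}
    {D : ∀ x : N, Submodule ℝ (TangentSpace (𝓡 n) x)} :
    coordField c X z ∈ coordDistribution c D z ↔ X (c.symm z) ∈ D (c.symm z) := by
  obtain ⟨A, hA, hAX⟩ := exists_equiv_mfderiv_symm hc hz
  rw [← hAX X, hA]
  rfl

lemma span_coordField (hc : c ∈ IsManifold.maximalAtlas (𝓡 n) ∞ N)
    {z : EuclideanSpace ℝ (Fin n)} (hz : z ∈ c.target) {κ : Type*}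
    {X : κ → ∀ x : N, TangentSpace (𝓡 n) x} {D : ∀ x : N, Submodule ℝ (TangentSpace (𝓡 n) x)}
    (hX : Submodule.span ℝ (range fun i ↦ X i (c.symm z)) = D (c.symm z)) :
    Submodule.span ℝ (range fun i ↦ coordField c (X i) z) = coordDistribution c D z := by
  obtain ⟨A, hA, hAX⟩ := exists_equiv_mfderiv_symm hc hz
  have hcomap : coordDistribution c D z = (D (c.symm z)).comap A.toLinearEquiv.toLinearMap := by
    ext v
    exact (congrArg (· ∈ D (c.symm z)) (hA v)).symm.to_iff
  refine Submodule.map_injective_of_injective (f := A.toLinearEquiv.toLinearMap) A.injective ?_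
  rw [hcomap, Submodule.map_comap_eq_of_surjective A.surjective, Submodule.map_span, ← hX,
    ← range_comp]
  exact congrArg (fun S ↦ Submodule.span ℝ (range S)) (funext fun i ↦ hAX (X i))

lemma linearIndependent_coordField_iff (hc : c ∈ IsManifold.maximalAtlas (𝓡 n) ∞ N)
    {z : EuclideanSpace ℝ (Fin n)} (hz : z ∈ c.target) {κ : Type*}
    {X : κ → ∀ x : N, TangentSpace (𝓡 n) x} :
    (LinearIndependent ℝ fun i ↦ coordField c (X i) z) ↔
      LinearIndependent ℝ fun i ↦ X i (c.symm z) := by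
  obtain ⟨A, -, hAX⟩ := exists_equiv_mfderiv_symm hc hz
  rw [← A.toLinearEquiv.toLinearMap.linearIndependent_iff A.toLinearEquiv.ker]
  simp only [Function.comp_def, LinearEquiv.coe_coe, ContinuousLinearEquiv.coe_toLinearEquiv, hAX]

lemma mfderiv_mem_coordDistribution_iff (hc : c ∈ IsManifold.maximalAtlas (𝓡 n) ∞ N) {x : N}
    (hx : x ∈ c.source) {D : ∀ x : N, Submodule ℝ (TangentSpace (𝓡 n) x)}
    {v : TangentSpace (𝓡 n) x} :
    mfderiv (𝓡 n) (𝓡 n) c x v ∈ coordDistribution c D (c x) ↔ v ∈ D x := by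
  have hv : mfderiv (𝓡 n) (𝓡 n) c.symm (c x) (mfderiv (𝓡 n) (𝓡 n) c x v) = v :=
    congr($((mdifferentiable_of_mem_maximalAtlas hc).symm_comp_deriv hx) v)
  let D' : N → Submodule ℝ (EuclideanSpace ℝ (Fin n)) := D
  have hD : D' (c.symm (c x)) = D' x := congrArg D' (c.left_inv hx)
  change _ ∈ D' _ ↔ v ∈ D' x
  rw [hD]
  exact iff_of_eq (congrArg (· ∈ D' x) hv)

lemma isFlatOn_trans {p : ℕ} {D : ∀ x : N, Submodule ℝ (TangentSpace (𝓡 n) x)}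
    (hc : c ∈ IsManifold.maximalAtlas (𝓡 n) ∞ N)
    {e : OpenPartialHomeomorph (EuclideanSpace ℝ (Fin n)) (EuclideanSpace ℝ (Fin n))}
    (he : ContDiffOn ℝ ∞ e e.source)
    (hflat : ∀ z ∈ e.source, ∀ w, w ∈ coordDistribution c D z ↔ fderiv ℝ e z w ∈ modelLeaf n p) :
    IsFlatOn p D (c.trans e) := by
  rintro x ⟨hxc, hxe⟩ v
  have hce : mvfderiv (𝓡 n) (c.trans e) x v =
      fderiv ℝ e (c x) (mfderiv (𝓡 n) (𝓡 n) c x v) := by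
    have hediff : MDifferentiableAt (𝓡 n) (𝓡 n) e (c x) :=
      ((he.contDiffAt (e.open_source.mem_nhds hxe)).differentiableAt (by simp)).mdifferentiableAt
    refine congr($(mfderiv_comp x hediff
      ((mdifferentiable_of_mem_maximalAtlas hc).mdifferentiableAt hxc)) v).trans ?_
    rw [mfderiv_eq_fderiv]
    rfl
  rw [hce]
  exact (mfderiv_mem_coordDistribution_iff hc hxc).symm.trans (hflat (c x) hxe _)

variable [IsManifold (𝓡 n) ∞ N]

lemma minSmoothness_two_le_infty : minSmoothness ℝ 2 ≤ ∞ := by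
  rw [minSmoothness_of_isRCLikeNormedField]
  exact WithTop.coe_le_coe.2 (le_top : (2 : ℕ∞) ≤ ⊤)

instance isManifold_minSmoothness_two : IsManifold (𝓡 n) (minSmoothness ℝ 2) N :=
  .of_le minSmoothness_two_le_infty

lemma contDiffOn_coordField (hc : c ∈ IsManifold.maximalAtlas (𝓡 n) ∞ N)
    {X : ∀ x : N, TangentSpace (𝓡 n) x} {W : Set N} (hW : IsOpen W) (hX : VFSmoothOn X W) :
    ContDiffOn ℝ ∞ (coordField c X) (c.target ∩ c.symm ⁻¹' W) := fun z hz ↦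
  (contMDiffAt_vectorSpace_iff_contDiffAt.1 (ContMDiffAt.mpullback_vectorField_preimage (n := ∞)
    (hX.contMDiffAt (hW.mem_nhds hz.2)) (contMDiffAt_symm_of_mem_maximalAtlas hc hz.1)
    (isInvertible_mfderiv_symm_of_mem_maximalAtlas hc hz.1) (by simp))).contDiffWithinAt

lemma contDiffAt_coordField (hc : c ∈ IsManifold.maximalAtlas (𝓡 n) ∞ N) {x : N}
    (hx : x ∈ c.source) {X : ∀ x : N, TangentSpace (𝓡 n) x} {W : Set N} (hW : W ∈ 𝓝 x)
    (hX : VFSmoothOn X W) : ContDiffAt ℝ ∞ (coordField c X) (c x) :=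
  have hxW : c.symm (c x) ∈ interior W := by
    rwa [c.left_inv hx, mem_interior_iff_mem_nhds]
  (contDiffOn_coordField hc isOpen_interior (hX.mono interior_subset)).contDiffAt
    ((c.isOpen_inter_preimage_symm isOpen_interior).mem_nhds ⟨c.map_source hx, hxW⟩)

lemma VFSmoothOn.vfDiffAt {X : ∀ x : N, TangentSpace (𝓡 n) x} {W : Set N} {x : N}
    (hX : VFSmoothOn X W) (hW : W ∈ 𝓝 x) : VFDiffAt X x :=
  (hX.contMDiffAt hW).mdifferentiableAt (by simp)

lemma mlieBracket_eq_lieBracket {E : Type*} [NormedAddCommGroup E] [NormedSpace ℝ E]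
    (V W : ∀ x : E, TangentSpace 𝓘(ℝ, E) x) :
    VectorField.mlieBracket 𝓘(ℝ, E) V W = VectorField.lieBracket ℝ V W := by
  rw [← VectorField.mlieBracketWithin_univ, VectorField.mlieBracketWithin_eq_lieBracketWithin]
  exact VectorField.lieBracketWithin_univ

lemma coordField_mlieBracket (hc : c ∈ IsManifold.maximalAtlas (𝓡 n) ∞ N)
    {z : EuclideanSpace ℝ (Fin n)} (hz : z ∈ c.target) {X Y : ∀ x : N, TangentSpace (𝓡 n) x}
    (hX : VFDiffAt X (c.symm z)) (hY : VFDiffAt Y (c.symm z)) :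
    coordField c (VectorField.mlieBracket (𝓡 n) X Y) z =
      VectorField.lieBracket ℝ (coordField c X) (coordField c Y) z :=
  (VectorField.mpullback_mlieBracket (n := ∞) hX hY
    (contMDiffAt_symm_of_mem_maximalAtlas hc hz) minSmoothness_two_le_infty).trans
      (congrFun (mlieBracket_eq_lieBracket _ _) z)

lemma IsInvolutive.involutiveOn_coordDistribution {D : ∀ x : N, Submodule ℝ (TangentSpace (𝓡 n) x)}
    (hD : IsInvolutive D) (hc : c ∈ IsManifold.maximalAtlas (𝓡 n) ∞ N) :
    InvolutiveOn (coordDistribution c D) c.target := by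
  intro O V W hO hOc hV hW hVD hWD z hz
  let pull (V : EuclideanSpace ℝ (Fin n) → EuclideanSpace ℝ (Fin n)) :
    ∀ x : N, TangentSpace (𝓡 n) x := VectorField.mpullback (𝓡 n) (𝓡 n) c V
  have hpull (V : EuclideanSpace ℝ (Fin n) → EuclideanSpace ℝ (Fin n)) :
      EqOn (coordField c (pull V)) V O := fun y hy ↦ coordField_mpullback hc (hOc hy) V
  have hopen : IsOpen (c.source ∩ c ⁻¹' O) := c.isOpen_inter_preimage hO
  have hsmooth {V : EuclideanSpace ℝ (Fin n) → EuclideanSpace ℝ (Fin n)}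
      (hV : ContDiffOn ℝ ∞ V O) : VFSmoothOn (pull V) (c.source ∩ c ⁻¹' O) := fun x hx ↦
    (ContMDiffAt.mpullback_vectorField_preimage (n := ∞)
      (contMDiffAt_vectorSpace_iff_contDiffAt.2 ((hV _ hx.2).contDiffAt (hO.mem_nhds hx.2)))
      (contMDiffAt_of_mem_maximalAtlas hc hx.1)
      (isInvertible_mfderiv_of_mem_maximalAtlas hc hx.1) (by simp)).contMDiffWithinAt
  have hmem {V : EuclideanSpace ℝ (Fin n) → EuclideanSpace ℝ (Fin n)}
      (hVD : ∀ z ∈ O, V z ∈ coordDistribution c D z) (x : N) (hx : x ∈ c.source ∩ c ⁻¹' O) :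
      pull V x ∈ D x := by
    have hpullD := (coordField_mem_iff hc (c.map_source hx.1) (X := pull V)).1
      (hpull V hx.2 ▸ hVD _ hx.2)
    rwa [c.left_inv hx.1] at hpullD
  have hzmem : c.symm z ∈ c.source ∩ c ⁻¹' O :=
    ⟨c.map_target (hOc hz), by rwa [mem_preimage, c.right_inv (hOc hz)]⟩
  have hbracket := (coordField_mem_iff hc (hOc hz)).2
    (hD _ _ _ hopen (hsmooth hV) (hsmooth hW) (hmem hVD) (hmem hWD) _ hzmem)
  rwa [coordField_mlieBracket hc (hOc hz) ((hsmooth hV).vfDiffAt (hopen.mem_nhds hzmem))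
      ((hsmooth hW).vfDiffAt (hopen.mem_nhds hzmem)),
    ((hpull V).eventuallyEq_of_mem (hO.mem_nhds hz)).lieBracket_vectorField_eq
      ((hpull W).eventuallyEq_of_mem (hO.mem_nhds hz))] at hbracket

lemma trans_mem_maximalAtlas (hc : c ∈ IsManifold.maximalAtlas (𝓡 n) ∞ N)
    {e : OpenPartialHomeomorph (EuclideanSpace ℝ (Fin n)) (EuclideanSpace ℝ (Fin n))}
    (he : ContDiffOn ℝ ∞ e e.source) (he' : ContDiffOn ℝ ∞ e.symm e.target) :
    c.trans e ∈ IsManifold.maximalAtlas (𝓡 n) ∞ N := by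
  refine OpenPartialHomeomorph.mem_maximalAtlas_of_contMDiffOn _ ?_ ?_
  · exact he.contMDiffOn.comp
      ((contMDiffOn_of_mem_maximalAtlas hc).mono (inter_subset_left (t := c ⁻¹' e.source)))
      fun _ hy ↦ hy.2
  · exact (contMDiffOn_symm_of_mem_maximalAtlas hc).comp
      (he'.contMDiffOn.mono (inter_subset_left (t := e.symm ⁻¹' c.target))) fun _ hy ↦ hy.2

lemma finrank_modelLeaf {p : ℕ} (hp : p ≤ n) : Module.finrank ℝ (modelLeaf n p) = p := by
  let coords : modelLeaf n p ≃ₗ[ℝ] (Fin p → ℝ) :=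
    { toFun v i := v.1 (Fin.castLE hp i)
      map_add' _ _ := rfl
      map_smul' _ _ := rfl
      invFun u := ⟨WithLp.toLp 2 fun j ↦ if h : j.val < p then u ⟨j, h⟩ else 0,
        fun i hi ↦ dif_neg hi.not_gt⟩
      left_inv v := by
        ext j
        by_cases h : j.val < p
        · simp [h]
        · simp [h, v.2 j (not_lt.1 h)]
      right_inv u := by
        ext i
        simp }
  rw [coords.finrank_eq, Module.finrank_fin_fun]

theorem IsInvolutive.isIntegrable {p : ℕ} {D : ∀ x : N, Submodule ℝ (TangentSpace (𝓡 n) x)}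
    (hinv : IsInvolutive D) (hD : IsDistribution p D) : IsIntegrable p D := by
  intro x
  obtain ⟨U, X, hU, hxU, hX, hframe⟩ := hD x
  let c := chartAt (EuclideanSpace ℝ (Fin n)) x
  have hc : c ∈ IsManifold.maximalAtlas (𝓡 n) ∞ N := IsManifold.chart_mem_maximalAtlas x
  have hxc : x ∈ c.source := mem_chart_source _ x
  have hcx : c x ∈ c.target ∩ c.symm ⁻¹' U :=
    ⟨c.map_source hxc, by rwa [mem_preimage, c.left_inv hxc]⟩
  have hli := (linearIndependent_coordField_iff hc hcx.1).2 (hframe _ hcx.2).1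
  have hrank : Module.finrank ℝ (modelLeaf n p) = Fintype.card (Fin p) := by
    rw [finrank_modelLeaf (by simpa using hli.fintype_card_le_finrank), Fintype.card_fin]
  obtain ⟨e, hxe, -, he, he', hflat⟩ := exists_straightening_of_frame
    (c.isOpen_inter_preimage_symm hU) (fun i ↦ contDiffOn_coordField hc hU (hX i))
    (fun z hz ↦ span_coordField hc hz.1 (hframe _ hz.2).2) hcx hli
    ((hinv.involutiveOn_coordDistribution hc).mono inter_subset_left) hrank
  exact ⟨c.trans e, trans_mem_maximalAtlas hc he he', ⟨hxc, hxe⟩, isFlatOn_trans hc he hflat⟩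

end Charts

section Foliations

section SlicePreserving

variable {E F : Type*} [NormedAddCommGroup E] [NormedSpace ℝ E] [NormedAddCommGroup F]
  [NormedSpace ℝ F] {S : Submodule ℝ E} {T : Submodule ℝ F} {f : E → F}

lemma sub_mem_of_fderiv_mem {s : Set E} (hs : Convex ℝ s) (hT : IsClosed (T : Set F))
    (hf : ∀ z ∈ s, DifferentiableAt ℝ f z) (hfS : ∀ z ∈ s, ∀ v ∈ S, fderiv ℝ f z v ∈ T) {a b : E}
    (ha : a ∈ s) (hb : b ∈ s) (hab : a - b ∈ S) : f a - f b ∈ T := by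
  let q : F →L[ℝ] F ⧸ T := T.mkQL
  have hline : ∀ t ∈ Icc (0 : ℝ) 1,
      HasDerivAt (fun t : ℝ ↦ q (f (b + t • (a - b)))) 0 t := fun t ht ↦ by
    have hz : b + t • (a - b) ∈ s := hs.add_smul_sub_mem hb ha ht
    have hder : HasDerivAt (fun t : ℝ ↦ b + t • (a - b)) (a - b) t := by
      simpa using ((hasDerivAt_id t).smul_const (a - b)).const_add b
    have hzero : q (fderiv ℝ f (b + t • (a - b)) (a - b)) = 0 :=
      (Submodule.Quotient.mk_eq_zero T).2 (hfS _ hz _ hab)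
    exact hzero ▸ q.hasFDerivAt.comp_hasDerivAt t ((hf _ hz).hasFDerivAt.comp_hasDerivAt t hder)
  have hconst := constant_of_has_deriv_right_zero
    (fun t ht ↦ (hline t ht).continuousAt.continuousWithinAt)
    (fun t ht ↦ (hline t (Ico_subset_Icc_self ht)).hasDerivWithinAt) 1 (right_mem_Icc.2 zero_le_one)
  refine (Submodule.Quotient.eq T).1 ?_
  simpa [q] using hconst

lemma hasFDerivAt_apply_mem_of_sub_mem {f' : E →L[ℝ] F} {z : E} (hf : HasFDerivAt f f' z)
    (hT : IsClosed (T : Set F)) (h : ∀ᶠ w in 𝓝 z, w - z ∈ S → f w - f z ∈ T) {v : E}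
    (hv : v ∈ S) : f' v ∈ T := by
  have htendsto : Filter.Tendsto (fun t : ℝ ↦ z + t • v) (𝓝[≠] 0) (𝓝 z) :=
    (Continuous.tendsto' (by fun_prop) 0 z (by simp)).mono_left nhdsWithin_le_nhds
  refine hT.mem_of_tendsto (hf.hasLineDerivAt v).tendsto_slope_zero ?_
  filter_upwards [htendsto.eventually h] with t ht
  exact T.smul_mem _ (ht (by simpa using S.smul_mem t hv))

end SlicePreserving

variable {n : ℕ} {N : Type*} [TopologicalSpace N]
  {φ ψ : OpenPartialHomeomorph N (EuclideanSpace ℝ (Fin n))} {p : ℕ}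

lemma map_mem_source_transition {x : N} (hxφ : x ∈ φ.source) (hxψ : x ∈ ψ.source) :
    φ x ∈ (φ.symm.trans ψ).source :=
  ⟨φ.map_source hxφ, (congrArg (· ∈ ψ.source) (φ.left_inv hxφ)).mpr hxψ⟩

lemma isClosed_modelLeaf : IsClosed (modelLeaf n p : Set (EuclideanSpace ℝ (Fin n))) :=
  (modelLeaf n p).closed_of_finiteDimensional

variable [ChartedSpace (EuclideanSpace ℝ (Fin n)) N]
  {D : ∀ x : N, Submodule ℝ (TangentSpace (𝓡 n) x)}

lemma differentiableAt_transition (hφ : φ ∈ IsManifold.maximalAtlas (𝓡 n) ∞ N)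
    (hψ : ψ ∈ IsManifold.maximalAtlas (𝓡 n) ∞ N) {z : EuclideanSpace ℝ (Fin n)}
    (hz : z ∈ (φ.symm.trans ψ).source) : DifferentiableAt ℝ (ψ ∘ φ.symm) z :=
  mdifferentiableAt_iff_differentiableAt.1
    (((mdifferentiable_of_mem_maximalAtlas hψ).mdifferentiableAt hz.2).comp z
      ((mdifferentiable_of_mem_maximalAtlas hφ).mdifferentiableAt_symm hz.1))

lemma fderiv_transition_apply (hφ : φ ∈ IsManifold.maximalAtlas (𝓡 n) ∞ N)
    (hψ : ψ ∈ IsManifold.maximalAtlas (𝓡 n) ∞ N) {x : N} (hxφ : x ∈ φ.source)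
    (hxψ : x ∈ ψ.source) (v : TangentSpace (𝓡 n) x) :
    fderiv ℝ (ψ ∘ φ.symm) (φ x) (mvfderiv (𝓡 n) φ x v) = mvfderiv (𝓡 n) ψ x v := by
  have hcomp : (ψ ∘ φ.symm) ∘ φ =ᶠ[𝓝 x] ψ :=
    Filter.eventuallyEq_of_mem (φ.open_source.mem_nhds hxφ) fun y hy ↦ congrArg ψ (φ.left_inv hy)
  have hchain := mfderiv_comp x
    (differentiableAt_transition hφ hψ (map_mem_source_transition hxφ hxψ)).mdifferentiableAt
    ((mdifferentiable_of_mem_maximalAtlas hφ).mdifferentiableAt hxφ)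
  rw [mfderiv_eq_fderiv, hcomp.mfderiv_eq] at hchain
  exact congr($hchain v).symm

lemma exists_mvfderiv_eq (hφ : φ ∈ IsManifold.maximalAtlas (𝓡 n) ∞ N) {x : N}
    (hx : x ∈ φ.source) (a : EuclideanSpace ℝ (Fin n)) : ∃ v, mvfderiv (𝓡 n) φ x v = a := by
  obtain ⟨A, hA⟩ := isInvertible_mfderiv_of_mem_maximalAtlas hφ hx
  exact ⟨A.symm a, congr($hA (A.symm a)).symm.trans (A.apply_symm_apply a)⟩

lemma PlaqueCompatible.of_isFlatOn (hφ : φ ∈ IsManifold.maximalAtlas (𝓡 n) ∞ N)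
    (hψ : ψ ∈ IsManifold.maximalAtlas (𝓡 n) ∞ N) (hφD : IsFlatOn p D φ) (hψD : IsFlatOn p D ψ) :
    PlaqueCompatible p φ ψ := by
  intro z hz
  obtain ⟨δ, hδ, hball⟩ := Metric.isOpen_iff.1 (φ.symm.trans ψ).open_source z hz
  have hleaf : ∀ y ∈ (φ.symm.trans ψ).source, ∀ a ∈ modelLeaf n p,
      fderiv ℝ (ψ ∘ φ.symm) y a ∈ modelLeaf n p := by
    rintro y ⟨hy, hyψ⟩ a ha
    have hxφ : φ.symm y ∈ φ.source := φ.map_target hy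
    obtain ⟨v, rfl⟩ := exists_mvfderiv_eq hφ hxφ a
    have hv := fderiv_transition_apply hφ hψ hxφ hyψ v
    rw [φ.right_inv hy] at hv
    rw [hv]
    exact (hψD _ hyψ v).1 ((hφD _ hxφ v).2 ha)
  exact ⟨Metric.ball z δ, Metric.isOpen_ball, Metric.mem_ball_self hδ, hball,
    fun a ha b hb hab ↦ sub_mem_of_fderiv_mem (convex_ball z δ) isClosed_modelLeaf
      (fun y hy ↦ differentiableAt_transition hφ hψ (hball hy)) (fun y hy ↦ hleaf y (hball hy))
      ha hb hab⟩

lemma PlaqueCompatible.mvfderiv_mem (h : PlaqueCompatible p φ ψ)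
    (hφ : φ ∈ IsManifold.maximalAtlas (𝓡 n) ∞ N) (hψ : ψ ∈ IsManifold.maximalAtlas (𝓡 n) ∞ N)
    {x : N} (hxφ : x ∈ φ.source) (hxψ : x ∈ ψ.source) {v : TangentSpace (𝓡 n) x}
    (hv : mvfderiv (𝓡 n) φ x v ∈ modelLeaf n p) : mvfderiv (𝓡 n) ψ x v ∈ modelLeaf n p := by
  have hx := map_mem_source_transition hxφ hxψ
  obtain ⟨W, hW, hxW, -, hWleaf⟩ := h (φ x) hx
  rw [← fderiv_transition_apply hφ hψ hxφ hxψ]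
  exact hasFDerivAt_apply_mem_of_sub_mem (differentiableAt_transition hφ hψ hx).hasFDerivAt
    isClosed_modelLeaf (Filter.eventually_of_mem (hW.mem_nhds hxW) fun w hw ↦ hWleaf w hw _ hxW) hv

/-- The foliation defined by an integrable distribution: its charts are all the flat charts. -/
def IsIntegrable.foliation (hD : IsIntegrable p D) : Foliation n N p where
  atlas := {φ | φ ∈ IsManifold.maximalAtlas (𝓡 n) ∞ N ∧ IsFlatOn p D φ}
  subset_maximalAtlas _ h := h.1
  covers x :=
    let ⟨φ, hφ, hx, hφD⟩ := hD x
    ⟨φ, ⟨hφ, hφD⟩, hx⟩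
  compatible _ hφ _ hψ := .of_isFlatOn hφ.1 hψ.1 hφ.2 hψ.2
  maximal φ hφ h := ⟨hφ, fun x hx v ↦ by
    obtain ⟨ψ, hψ, hxψ, hψD⟩ := hD x
    obtain ⟨hφψ, hψφ⟩ := h ψ ⟨hψ, hψD⟩
    exact (hψD x hxψ v).trans
      ⟨fun hv ↦ hψφ.mvfderiv_mem hψ hφ hxψ hx hv, fun hv ↦ hφψ.mvfderiv_mem hφ hψ hx hxψ hv⟩⟩

theorem IsIntegrable.existsUnique_foliation (hD : IsIntegrable p D) :
    ∃! F : Foliation n N p, F.HasStructuralDistribution D := by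
  refine ⟨hD.foliation, fun φ hφ ↦ hφ.2, fun F hF ↦ Foliation.ext (Subset.antisymm ?_ ?_)⟩
  · exact fun φ hφ ↦ ⟨F.subset_maximalAtlas hφ, hF φ hφ⟩
  · rintro φ ⟨hφ, hφD⟩
    refine F.maximal φ hφ fun ψ hψ ↦ ?_
    have hψ' := F.subset_maximalAtlas hψ
    exact ⟨.of_isFlatOn hφ hψ' hφD (hF ψ hψ), .of_isFlatOn hψ' hφ (hF ψ hψ) hφD⟩

end Foliations

section RelatedFields

lemma lieBracket_linear_conj {E F : Type*} [NormedAddCommGroup E] [NormedSpace ℝ E]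
    [NormedAddCommGroup F] [NormedSpace ℝ F] {A : F →L[ℝ] E} {B : E →L[ℝ] F}
    (hAB : Function.LeftInverse A B) {V W : E → E} {z : E} (hV : DifferentiableAt ℝ V z)
    (hW : DifferentiableAt ℝ W z) :
    VectorField.lieBracket ℝ (fun w ↦ B (V (A w))) (fun w ↦ B (W (A w))) (B z) =
      B (VectorField.lieBracket ℝ V W z) := by
  have hderiv {X : E → E} (hX : DifferentiableAt ℝ X z) :
      fderiv ℝ (fun w ↦ B (X (A w))) (B z) = B ∘L (fderiv ℝ X z ∘L A) :=
    (B.hasFDerivAt.comp (B z) (HasFDerivAt.comp (B z) ((hAB z).symm ▸ hX.hasFDerivAt)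
      A.hasFDerivAt)).fderiv
  simp only [VectorField.lieBracket, hderiv hV, hderiv hW, ContinuousLinearMap.comp_apply, hAB _,
    map_sub]

variable {d : ℕ} {M : Type*} [TopologicalSpace M] [ChartedSpace (EuclideanSpace ℝ (Fin d)) M]
  {n : ℕ} {N : Type*} [TopologicalSpace N] [ChartedSpace (EuclideanSpace ℝ (Fin n)) N]
  {ι : N → M}

/-- The vector fields `X` on `N` and `X'` on `M` are related by `ι` near `x`. -/
def IsRelatedAt (ι : N → M) (x : N) (X : ∀ x : N, TangentSpace (𝓡 n) x)
    (X' : ∀ y : M, TangentSpace (𝓡 d) y) : Prop :=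
  ∀ᶠ y in 𝓝 x, mfderiv (𝓡 n) (𝓡 d) ι y (X y) = X' (ι y)

/-- The charts `φ` and `ψ` express `ι` as the restriction of an injective linear map `B`; the left
inverse `A` of `B` is part of the data. -/
structure IsLinearInCharts (ι : N → M) (φ : OpenPartialHomeomorph N (EuclideanSpace ℝ (Fin n)))
    (ψ : OpenPartialHomeomorph M (EuclideanSpace ℝ (Fin d)))
    (A : EuclideanSpace ℝ (Fin d) →L[ℝ] EuclideanSpace ℝ (Fin n))
    (B : EuclideanSpace ℝ (Fin n) →L[ℝ] EuclideanSpace ℝ (Fin d)) : Prop where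
  dom_mem : φ ∈ IsManifold.maximalAtlas (𝓡 n) ∞ N
  cod_mem : ψ ∈ IsManifold.maximalAtlas (𝓡 d) ∞ M
  mapsTo : MapsTo ι φ.source ψ.source
  leftInverse : Function.LeftInverse A B
  apply_eq : ∀ y ∈ φ.source, ψ (ι y) = B (φ y)

/-- The extension to `M` of a vector field on `N`, for charts `φ` and `ψ` in which `N → M` is the
linear map `B` with left inverse `A`: in the chart `ψ` it is constant along the fibres of `A`. -/
def extendField (φ : OpenPartialHomeomorph N (EuclideanSpace ℝ (Fin n)))
    (ψ : OpenPartialHomeomorph M (EuclideanSpace ℝ (Fin d)))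
    (A : EuclideanSpace ℝ (Fin d) →L[ℝ] EuclideanSpace ℝ (Fin n))
    (B : EuclideanSpace ℝ (Fin n) →L[ℝ] EuclideanSpace ℝ (Fin d))
    (X : ∀ x : N, TangentSpace (𝓡 n) x) : ∀ y : M, TangentSpace (𝓡 d) y :=
  VectorField.mpullback (𝓡 d) (𝓡 d) ψ fun w ↦ B (coordField φ X (A w))

lemma exists_isLinearInCharts {x : N} (hι : IsImmersionAt (𝓡 n) (𝓡 d) ∞ ι x) :
    ∃ φ ψ A B, IsLinearInCharts (n := n) (d := d) ι φ ψ A B ∧ x ∈ φ.source := by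
  refine ⟨hι.domChart, hι.codChart, .fst ℝ _ _ ∘L hι.equiv.symm.toContinuousLinearMap,
    hι.equiv.toContinuousLinearMap ∘L .inl ℝ _ _,
    ⟨hι.domChart_mem_maximalAtlas, hι.codChart_mem_maximalAtlas, hι.source_subset_preimage_source,
      fun z ↦ by simp, fun y hy ↦ ?_⟩, hι.mem_domChart_source⟩
  have hwritten := hι.writtenInCharts
    (hι.domChart.extend_target_eq_image_source (I := 𝓡 n) ▸ mem_image_of_mem _ hy)
  simpa [hι.domChart.left_inv hy] using hwritten

variable {φ : OpenPartialHomeomorph N (EuclideanSpace ℝ (Fin n))}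
  {ψ : OpenPartialHomeomorph M (EuclideanSpace ℝ (Fin d))}
  {A : EuclideanSpace ℝ (Fin d) →L[ℝ] EuclideanSpace ℝ (Fin n)}
  {B : EuclideanSpace ℝ (Fin n) →L[ℝ] EuclideanSpace ℝ (Fin d)}

namespace IsLinearInCharts

lemma mfderiv_mfderiv (h : IsLinearInCharts ι φ ψ A B) {x : N} (hx : x ∈ φ.source)
    (hι : MDifferentiableAt (𝓡 n) (𝓡 d) ι x) (v : TangentSpace (𝓡 n) x) :
    mfderiv (𝓡 d) (𝓡 d) ψ (ι x) (mfderiv (𝓡 n) (𝓡 d) ι x v) =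
      B (mfderiv (𝓡 n) (𝓡 n) φ x v) := by
  have hψι := congr($(mfderiv_comp x
    ((mdifferentiable_of_mem_maximalAtlas h.cod_mem).mdifferentiableAt (h.mapsTo hx)) hι) v)
  have hBφ := congr($(mfderiv_comp x B.differentiableAt.mdifferentiableAt
    ((mdifferentiable_of_mem_maximalAtlas h.dom_mem).mdifferentiableAt hx)) v)
  have heq : ψ ∘ ι =ᶠ[𝓝 x] B ∘ φ :=
    Filter.eventuallyEq_of_mem (φ.open_source.mem_nhds hx) h.apply_eq
  refine hψι.symm.trans (congr($heq.mfderiv_eq v).trans (hBφ.trans ?_))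
  rw [mfderiv_eq_fderiv, B.fderiv]
  rfl

lemma coordField_extendField (h : IsLinearInCharts ι φ ψ A B) (X : ∀ x : N, TangentSpace (𝓡 n) x) :
    EqOn (coordField ψ (extendField φ ψ A B X)) (fun w ↦ B (coordField φ X (A w))) ψ.target :=
  fun _ hw ↦ coordField_mpullback h.cod_mem hw _

lemma mfderiv_apply_eq_extendField (h : IsLinearInCharts ι φ ψ A B) {x : N} (hx : x ∈ φ.source)
    (hι : MDifferentiableAt (𝓡 n) (𝓡 d) ι x) (X : ∀ x : N, TangentSpace (𝓡 n) x) :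
    mfderiv (𝓡 n) (𝓡 d) ι x (X x) = extendField φ ψ A B X (ι x) := by
  have hcoord : B (coordField φ X (A (ψ (ι x)))) = B (mfderiv (𝓡 n) (𝓡 n) φ x (X x)) := by
    rw [h.apply_eq x hx, h.leftInverse, coordField_apply h.dom_mem hx]
  exact ((isInvertible_mfderiv_of_mem_maximalAtlas h.cod_mem (h.mapsTo hx)).inverse_apply_eq.2
    (hcoord.trans (h.mfderiv_mfderiv hx hι (X x)).symm)).symm

variable [IsManifold (𝓡 d) ∞ M] [IsManifold (𝓡 n) ∞ N] {x : N} {W : Set N}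
  {X Y : ∀ x : N, TangentSpace (𝓡 n) x}

lemma contMDiffAt_extendField (h : IsLinearInCharts ι φ ψ A B) (hx : x ∈ φ.source) (hW : W ∈ 𝓝 x)
    (hX : VFSmoothOn X W) :
    ContMDiffAt (𝓡 d) (𝓡 d).tangent ∞
      (fun y ↦ (⟨y, extendField φ ψ A B X y⟩ : TangentBundle (𝓡 d) M)) (ι x) := by
  have hXφ : ContDiffAt ℝ ∞ (coordField φ X) (A (ψ (ι x))) := by
    rw [h.apply_eq x hx, h.leftInverse]
    exact contDiffAt_coordField h.dom_mem hx hW hX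
  exact ContMDiffAt.mpullback_vectorField_preimage (n := ∞)
    (contMDiffAt_vectorSpace_iff_contDiffAt.2
      (B.contDiff.contDiffAt.comp _ (hXφ.comp _ A.contDiff.contDiffAt)))
    (contMDiffAt_of_mem_maximalAtlas h.cod_mem (h.mapsTo hx))
    (isInvertible_mfderiv_of_mem_maximalAtlas h.cod_mem (h.mapsTo hx)) (by simp)

lemma mfderiv_mlieBracket_eq (h : IsLinearInCharts ι φ ψ A B) (hx : x ∈ φ.source)
    (hι : MDifferentiableAt (𝓡 n) (𝓡 d) ι x) (hW : W ∈ 𝓝 x)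
    (hX : VFSmoothOn X W) (hY : VFSmoothOn Y W) :
    mfderiv (𝓡 n) (𝓡 d) ι x (VectorField.mlieBracket (𝓡 n) X Y x) =
      VectorField.mlieBracket (𝓡 d) (extendField φ ψ A B X) (extendField φ ψ A B Y) (ι x) := by
  have hψx : ψ (ι x) ∈ ψ.target := ψ.map_source (h.mapsTo hx)
  have hcoord {X : ∀ x : N, TangentSpace (𝓡 n) x} (hX : VFSmoothOn X W) :
      DifferentiableAt ℝ (coordField φ X) (φ x) :=
    (contDiffAt_coordField h.dom_mem hx hW hX).differentiableAt (by simp)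
  have hvf {X : ∀ x : N, TangentSpace (𝓡 n) x} (hX : VFSmoothOn X W) :
      VFDiffAt X (φ.symm (φ x)) :=
    (φ.left_inv hx).symm ▸ hX.vfDiffAt hW
  have hext {X : ∀ x : N, TangentSpace (𝓡 n) x} (hX : VFSmoothOn X W) :
      VFDiffAt (extendField φ ψ A B X) (ψ.symm (ψ (ι x))) :=
    (ψ.left_inv (h.mapsTo hx)).symm ▸
      (h.contMDiffAt_extendField hx hW hX).mdifferentiableAt (by simp)
  have hleft : mfderiv (𝓡 d) (𝓡 d) ψ (ι x) (mfderiv (𝓡 n) (𝓡 d) ι x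
      (VectorField.mlieBracket (𝓡 n) X Y x)) =
      B (VectorField.lieBracket ℝ (coordField φ X) (coordField φ Y) (φ x)) :=
    (h.mfderiv_mfderiv hx hι _).trans (congrArg B ((coordField_apply h.dom_mem hx _).symm.trans
      (coordField_mlieBracket h.dom_mem (φ.map_source hx) (hvf hX) (hvf hY))))
  have hright : mfderiv (𝓡 d) (𝓡 d) ψ (ι x)
      (VectorField.mlieBracket (𝓡 d) (extendField φ ψ A B X) (extendField φ ψ A B Y) (ι x)) =
      B (VectorField.lieBracket ℝ (coordField φ X) (coordField φ Y) (φ x)) := by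
    refine (coordField_apply h.cod_mem (h.mapsTo hx) _).symm.trans
      ((coordField_mlieBracket h.cod_mem hψx (hext hX) (hext hY)).trans ?_)
    have heq X := (h.coordField_extendField X).eventuallyEq_of_mem (ψ.open_target.mem_nhds hψx)
    rw [(heq X).lieBracket_vectorField_eq (heq Y), h.apply_eq x hx]
    exact lieBracket_linear_conj h.leftInverse (hcoord hX) (hcoord hY)
  exact (isInvertible_mfderiv_of_mem_maximalAtlas h.cod_mem (h.mapsTo hx)).injective
    (hleft.trans hright.symm)

end IsLinearInCharts

variable [IsManifold (𝓡 d) ∞ M] [IsManifold (𝓡 n) ∞ N]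

lemma exists_related_fields (hι : IsImmersion (𝓡 n) (𝓡 d) ∞ ι) {x : N} {W : Set N}
    (hW : W ∈ 𝓝 x) :
    ∃ ext : (∀ x : N, TangentSpace (𝓡 n) x) → ∀ y : M, TangentSpace (𝓡 d) y,
      (∀ X, IsRelatedAt ι x X (ext X)) ∧
      (∀ X, VFSmoothOn X W → ContMDiffAt (𝓡 d) (𝓡 d).tangent ∞
        (fun y ↦ (⟨y, ext X y⟩ : TangentBundle (𝓡 d) M)) (ι x)) ∧
      ∀ X Y, VFSmoothOn X W → VFSmoothOn Y W →
        mfderiv (𝓡 n) (𝓡 d) ι x (VectorField.mlieBracket (𝓡 n) X Y x) =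
          VectorField.mlieBracket (𝓡 d) (ext X) (ext Y) (ι x) := by
  obtain ⟨φ, ψ, A, B, h, hx⟩ := exists_isLinearInCharts (hι.isImmersionAt x)
  have hdiff : MDifferentiable (𝓡 n) (𝓡 d) ι := hι.contMDiff.mdifferentiable (by simp)
  exact ⟨extendField φ ψ A B, fun X ↦ Filter.eventually_of_mem (φ.open_source.mem_nhds hx)
      fun y hy ↦ h.mfderiv_apply_eq_extendField hy (hdiff y) X,
    fun X hX ↦ h.contMDiffAt_extendField hx hW hX,
    fun X Y hX hY ↦ h.mfderiv_mlieBracket_eq hx (hdiff x) hW hX hY⟩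

end RelatedFields

section GramMatrix

open Matrix

variable {R V κ : Type*} [CommRing R] [AddCommGroup V] [Module R V]

/-- The Gram matrix of a family of vectors with respect to a bilinear form. -/
def gramMatrix (B : LinearMap.BilinForm R V) (v : κ → V) : Matrix κ κ R :=
  of fun i j ↦ B (v i) (v j)

variable [Fintype κ] [DecidableEq κ]

/-- A multiple of the projection of `w` onto the orthogonal complement of the family `v`. Clearing
the denominator `det (gramMatrix B v)` in Cramer's rule makes the formula polynomial. -/
def orthogonalize (B : LinearMap.BilinForm R V) (v : κ → V) (w : V) : V :=
  (gramMatrix B v).det • w - ∑ i, (gramMatrix B v).cramer (fun j ↦ B (v j) w) i • v i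

lemma apply_orthogonalize (B : LinearMap.BilinForm R V) (v : κ → V) (w : V) (i : κ) :
    B (v i) (orthogonalize B v w) = 0 := by
  have hcramer := congrFun ((gramMatrix B v).mulVec_cramer fun j ↦ B (v j) w) i
  simp only [mulVec, dotProduct, gramMatrix, of_apply, Pi.smul_apply, smul_eq_mul] at hcramer
  simp only [orthogonalize, map_sub, map_smul, map_sum, smul_eq_mul, gramMatrix, ← hcramer,
    mul_comm, sub_self]

lemma orthogonalize_of_orthogonal {B : LinearMap.BilinForm R V} {v : κ → V} {w : V}
    (hw : ∀ i, B (v i) w = 0) : orthogonalize B v w = (gramMatrix B v).det • w := by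
  have hzero : (fun j ↦ B (v j) w) = 0 := funext hw
  simp only [orthogonalize, hzero, map_zero, Pi.zero_apply, zero_smul, Finset.sum_const_zero,
    sub_zero]

lemma det_gramMatrix_ne_zero [IsDomain R] {B : LinearMap.BilinForm R V} {v : κ → V}
    (hv : LinearIndependent R v)
    (hB : ∀ x ∈ Submodule.span R (range v), (∀ i, B (v i) x = 0) → x = 0) :
    (gramMatrix B v).det ≠ 0 := by
  intro hdet
  obtain ⟨a, ha, hGa⟩ := exists_mulVec_eq_zero_iff.2 hdet
  have hsum : ∑ i, a i • v i = 0 := by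
    refine hB _ (Submodule.sum_mem _ fun i _ ↦
      Submodule.smul_mem _ _ (Submodule.subset_span ⟨i, rfl⟩)) fun i ↦ ?_
    simpa only [map_sum, map_smul, smul_eq_mul, mulVec, dotProduct, gramMatrix, of_apply,
      Pi.zero_apply, mul_comm] using congrFun hGa i
  exact ha (funext (Fintype.linearIndependent_iff.1 hv a hsum))

end GramMatrix

section Sections

variable {n : ℕ} {N : Type*} [TopologicalSpace N] [ChartedSpace (EuclideanSpace ℝ (Fin n)) N]

lemma contMDiffOn_matrix_det {κ : Type*} [Fintype κ] [DecidableEq κ] {A : N → Matrix κ κ ℝ}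
    {W : Set N} (hA : ∀ i j, ContMDiffOn (𝓡 n) 𝓘(ℝ, ℝ) ∞ (fun y ↦ A y i j) W) :
    ContMDiffOn (𝓡 n) 𝓘(ℝ, ℝ) ∞ (fun y ↦ (A y).det) W := by
  simp only [Matrix.det_apply']
  exact contMDiffOn_finsetSum fun τ _ ↦
    contMDiffOn_const.mul (contMDiffOn_finsetProd fun i _ ↦ hA (τ i) i)

instance finiteDimensional_tangentSpace (x : N) : FiniteDimensional ℝ (TangentSpace (𝓡 n) x) :=
  inferInstanceAs (FiniteDimensional ℝ (EuclideanSpace ℝ (Fin n)))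

lemma finrank_tangentSpace (x : N) : Module.finrank ℝ (TangentSpace (𝓡 n) x) = n :=
  finrank_euclideanSpace_fin (𝕜 := ℝ) (n := n)

variable [IsManifold (𝓡 n) ∞ N]

lemma exists_vfSmoothOn_apply_eq (x : N) (v : TangentSpace (𝓡 n) x) :
    ∃ W, IsOpen W ∧ x ∈ W ∧ ∃ V : ∀ x : N, TangentSpace (𝓡 n) x, VFSmoothOn V W ∧ V x = v := by
  let c := chartAt (EuclideanSpace ℝ (Fin n)) x
  have hc : c ∈ IsManifold.maximalAtlas (𝓡 n) ∞ N := IsManifold.chart_mem_maximalAtlas x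
  have hx : x ∈ c.source := mem_chart_source _ x
  refine ⟨c.source, c.open_source, hx,
    VectorField.mpullback (𝓡 n) (𝓡 n) c fun _ ↦ mfderiv (𝓡 n) (𝓡 n) c x v, fun y hy ↦ ?_, ?_⟩
  · exact (ContMDiffAt.mpullback_vectorField_preimage (n := ∞)
      (contMDiffAt_vectorSpace_iff_contDiffAt.2 contDiffAt_const)
      (contMDiffAt_of_mem_maximalAtlas hc hy)
      (isInvertible_mfderiv_of_mem_maximalAtlas hc hy) (by simp)).contMDiffWithinAt
  · exact (isInvertible_mfderiv_of_mem_maximalAtlas hc hx).inverse_apply_eq.2 rfl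

lemma eventually_linearIndependent {κ : Type*} [Finite κ] {X : κ → ∀ x : N, TangentSpace (𝓡 n) x}
    {x : N} {W : Set N} (hW : W ∈ 𝓝 x) (hX : ∀ i, VFSmoothOn (X i) W)
    (hli : LinearIndependent ℝ fun i ↦ X i x) :
    ∀ᶠ y in 𝓝 x, LinearIndependent ℝ fun i ↦ X i y := by
  let c := chartAt (EuclideanSpace ℝ (Fin n)) x
  have hc : c ∈ IsManifold.maximalAtlas (𝓡 n) ∞ N := IsManifold.chart_mem_maximalAtlas x
  have hx : x ∈ c.source := mem_chart_source _ x
  have hcont : ContinuousAt (fun y i ↦ coordField c (X i) (c y)) x := continuousAt_pi.2 fun i ↦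
    (contDiffAt_coordField hc hx hW (hX i)).continuousAt.comp (c.continuousAt hx)
  have hiff {y : N} (hy : y ∈ c.source) : (LinearIndependent ℝ fun i ↦ coordField c (X i) (c y)) ↔
      LinearIndependent ℝ fun i ↦ X i y := by
    rw [linearIndependent_coordField_iff hc (c.map_source hy), c.left_inv hy]
  filter_upwards [c.open_source.mem_nhds hx, hcont.eventually
    (isOpen_setOfPred_linearIndependent.eventually_mem ((hiff hx).2 hli))] with y hyc hy
  exact (hiff hyc).1 hy

lemma isDistribution_of_exists_section {p : ℕ} {D : ∀ x : N, Submodule ℝ (TangentSpace (𝓡 n) x)}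
    (hrank : ∀ x, Module.finrank ℝ (D x) = p)
    (hsection : ∀ x, ∀ v ∈ D x, ∃ W, IsOpen W ∧ x ∈ W ∧ ∃ V : ∀ x : N, TangentSpace (𝓡 n) x,
      VFSmoothOn V W ∧ V x = v ∧ ∀ y ∈ W, V y ∈ D y) : IsDistribution p D := by
  intro x
  let b := Module.finBasisOfFinrankEq ℝ (D x) (hrank x)
  choose W hWo hxW V hV hVx hVD using fun i ↦ hsection x (b i) (b i).2
  have hb : LinearIndependent ℝ fun i ↦ (b i : TangentSpace (𝓡 n) x) :=
    b.linearIndependent.map' (D x).subtype (D x).ker_subtype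
  have hli : LinearIndependent ℝ fun i ↦ V i x := by simpa only [hVx] using hb
  have hW : ⋂ i, W i ∈ 𝓝 x := (isOpen_iInter_of_finite hWo).mem_nhds (mem_iInter.2 hxW)
  have hVW i : VFSmoothOn (V i) (⋂ i, W i) := (hV i).mono (iInter_subset W i)
  obtain ⟨U, hU, hUo, hxU⟩ := mem_nhds_iff.1
    (Filter.inter_mem hW (eventually_linearIndependent hW hVW hli))
  refine ⟨U, V, hUo, hxU, fun i ↦ (hVW i).mono fun y hy ↦ (hU hy).1, fun y hy ↦ ⟨(hU hy).2, ?_⟩⟩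
  refine Submodule.eq_of_le_of_finrank_eq (Submodule.span_le.2 ?_) ?_
  · rintro _ ⟨i, rfl⟩
    exact hVD i y (mem_iInter.1 (hU hy).1 i)
  · rw [finrank_span_eq_card (hU hy).2, Fintype.card_fin, hrank]

end Sections

section OrthogonalDistribution

variable {d : ℕ} {M : Type*} [TopologicalSpace M] [ChartedSpace (EuclideanSpace ℝ (Fin d)) M]
  [IsManifold (𝓡 d) ∞ M] {g : SemiRiemannianMetric d M}
  {n : ℕ} {N : Type*} [TopologicalSpace N] [ChartedSpace (EuclideanSpace ℝ (Fin n)) N] {ι : N → M}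
  {D : ∀ x : N, Submodule ℝ (TangentSpace (𝓡 n) x)}

lemma contMDiffAt_metric_apply {X Y : ∀ x : M, TangentSpace (𝓡 d) x} {x : M}
    (hX : ContMDiffAt (𝓡 d) (𝓡 d).tangent ∞ (fun y ↦ (⟨y, X y⟩ : TangentBundle (𝓡 d) M)) x)
    (hY : ContMDiffAt (𝓡 d) (𝓡 d).tangent ∞ (fun y ↦ (⟨y, Y y⟩ : TangentBundle (𝓡 d) M)) x) :
    ContMDiffAt (𝓡 d) 𝓘(ℝ, ℝ) ∞ (fun y ↦ g.toFun y (X y) (Y y)) x :=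
  (contMDiffAt_section _).1 (ContMDiffAt.clm_bundle_apply₂ (b := fun y ↦ y) (E₃ := fun _ : M ↦ ℝ)
    (F₃ := ℝ) (g.contMDiff x) hX hY)

/-- The induced metric at `x`, as a bilinear form. -/
def inducedBilin (g : SemiRiemannianMetric d M) (ι : N → M) (x : N) :
    LinearMap.BilinForm ℝ (TangentSpace (𝓡 n) x) :=
  LinearMap.mk₂ ℝ (inducedMetric g ι x) (by simp [inducedMetric]) (by simp [inducedMetric])
    (by simp [inducedMetric]) (by simp [inducedMetric])

lemma inducedMetric_symm (x : N) (v w : TangentSpace (𝓡 n) x) :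
    inducedMetric g ι x v w = inducedMetric g ι x w v :=
  g.symm _ _ _

lemma mem_orthDistribution_of_span {κ : Type*} {x : N} {X : κ → TangentSpace (𝓡 n) x}
    (hX : Submodule.span ℝ (range X) = D x) {v : TangentSpace (𝓡 n) x} :
    v ∈ orthDistribution g ι D x ↔ ∀ i, inducedBilin g ι x (X i) v = 0 := by
  have hle : D x ≤ LinearMap.ker ((inducedBilin g ι x).flip v) ↔
      ∀ i, inducedBilin g ι x (X i) v = 0 := by
    rw [← hX, Submodule.span_le]
    exact range_subset_iff
  rw [← hle]
  exact forall₂_congr fun w _ ↦ by rw [inducedMetric_symm]; rfl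

lemma finrank_orthDistribution
    (hg : IsNondegenerateOn g ι fun x : N ↦ (⊤ : Submodule ℝ (TangentSpace (𝓡 n) x))) (x : N) :
    Module.finrank ℝ (orthDistribution g ι D x) = n - Module.finrank ℝ (D x) := by
  have hsymm : (inducedBilin (n := n) g ι x).IsSymm := ⟨inducedMetric_symm x⟩
  have hnondeg : (inducedBilin (n := n) g ι x).Nondegenerate :=
    hsymm.isRefl.nondegenerate_iff_separatingLeft.2 fun v hv ↦ hg x v trivial fun w _ ↦ hv w
  have horth : orthDistribution g ι D x = (inducedBilin g ι x).orthogonal (D x) := by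
    ext v
    exact forall₂_congr fun w _ ↦ by rw [inducedMetric_symm]; rfl
  rw [horth, LinearMap.BilinForm.finrank_orthogonal hnondeg, finrank_tangentSpace]

variable [IsManifold (𝓡 n) ∞ N]

lemma contMDiffOn_inducedMetric (hι : IsImmersion (𝓡 n) (𝓡 d) ∞ ι)
    {X Y : ∀ x : N, TangentSpace (𝓡 n) x} {W : Set N} (hW : IsOpen W) (hX : VFSmoothOn X W)
    (hY : VFSmoothOn Y W) :
    ContMDiffOn (𝓡 n) 𝓘(ℝ, ℝ) ∞ (fun y ↦ inducedMetric g ι y (X y) (Y y)) W := by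
  intro x hx
  obtain ⟨ext, hext, hsmooth, -⟩ := exists_related_fields hι (hW.mem_nhds hx)
  have hcomp := (contMDiffAt_metric_apply (g := g) (hsmooth X hX) (hsmooth Y hY)).comp x
    (hι.contMDiff x)
  refine (hcomp.congr_of_eventuallyEq ?_).contMDiffWithinAt
  filter_upwards [hext X, hext Y] with y hXy hYy
  simp only [inducedMetric, hXy, hYy, Function.comp_apply]

lemma vfSmoothOn_orthogonalize {κ : Type*} [Fintype κ] [DecidableEq κ]
    (hι : IsImmersion (𝓡 n) (𝓡 d) ∞ ι) {X : κ → ∀ x : N, TangentSpace (𝓡 n) x}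
    {Y : ∀ x : N, TangentSpace (𝓡 n) x} {W : Set N} (hW : IsOpen W)
    (hX : ∀ i, VFSmoothOn (X i) W) (hY : VFSmoothOn Y W) :
    VFSmoothOn (fun y ↦ orthogonalize (inducedBilin g ι y) (fun i ↦ X i y) (Y y)) W := by
  have hgram i j : ContMDiffOn (𝓡 n) 𝓘(ℝ, ℝ) ∞
      (fun y ↦ gramMatrix (inducedBilin g ι y) (fun i ↦ X i y) i j) W :=
    contMDiffOn_inducedMetric hι hW (hX i) (hX j)
  refine ((contMDiffOn_matrix_det hgram).smul_section hY).sub_section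
    (ContMDiffOn.sum_section fun i _ ↦ ContMDiffOn.smul_section ?_ (hX i))
  simp only [Matrix.cramer_apply]
  refine contMDiffOn_matrix_det fun j k ↦ ?_
  rcases eq_or_ne k i with rfl | hki
  · simp only [Matrix.updateCol_self]
    exact contMDiffOn_inducedMetric hι hW (hX j) hY
  · simpa only [Matrix.updateCol_ne hki] using hgram j k

lemma IsDistribution.finrank_eq {r : ℕ} (hD : IsDistribution r D) (x : N) :
    Module.finrank ℝ (D x) = r := by
  obtain ⟨W, X, -, hx, -, hframe⟩ := hD x
  rw [← (hframe x hx).2, finrank_span_eq_card (hframe x hx).1, Fintype.card_fin]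

lemma IsDistribution.orthDistribution {r : ℕ} (hD : IsDistribution r D)
    (hι : IsImmersion (𝓡 n) (𝓡 d) ∞ ι)
    (hg : IsNondegenerateOn g ι fun x : N ↦ (⊤ : Submodule ℝ (TangentSpace (𝓡 n) x)))
    (hgD : IsNondegenerateOn g ι D) : IsDistribution (n - r) (orthDistribution g ι D) := by
  refine isDistribution_of_exists_section
    (fun x ↦ (finrank_orthDistribution hg x).trans (by rw [hD.finrank_eq])) fun x v hv ↦ ?_
  obtain ⟨U, X, hU, hxU, hX, hframe⟩ := hD x
  have hdet : (gramMatrix (inducedBilin g ι x) fun i ↦ X i x).det ≠ 0 := by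
    refine det_gramMatrix_ne_zero (hframe x hxU).1 fun w hw hwX ↦ hgD x w ?_ ?_
    · rwa [(hframe x hxU).2] at hw
    · exact (mem_orthDistribution_of_span (hframe x hxU).2).2 hwX
  obtain ⟨W, hW, hxW, V, hV, hVx⟩ := exists_vfSmoothOn_apply_eq x
    ((gramMatrix (inducedBilin g ι x) fun i ↦ X i x).det⁻¹ • v)
  refine ⟨U ∩ W, hU.inter hW, ⟨hxU, hxW⟩,
    fun y ↦ orthogonalize (inducedBilin g ι y) (fun i ↦ X i y) (V y),
    vfSmoothOn_orthogonalize hι (hU.inter hW) (fun i ↦ (hX i).mono inter_subset_left)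
      (hV.mono inter_subset_right), ?_, fun y hy ↦ ?_⟩
  · have hvX := (mem_orthDistribution_of_span (hframe x hxU).2).1 hv
    beta_reduce
    rw [hVx, orthogonalize_of_orthogonal fun i ↦ by rw [map_smul, hvX, smul_zero],
      smul_inv_smul₀ hdet]
  · exact (mem_orthDistribution_of_span (hframe y hy.1).2).2
      (apply_orthogonalize (inducedBilin g ι y) (fun i ↦ X i y) (V y))

end OrthogonalDistribution

section Ambient

variable {d : ℕ} {M : Type*} [TopologicalSpace M] [ChartedSpace (EuclideanSpace ℝ (Fin d)) M]
  [IsManifold (𝓡 d) ∞ M] {σ : AlmostParaquaternionicStructure d M} {g : SemiRiemannianMetric d M}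
  {U : Set M} {J : Fin 3 → EndField d M} {x : M}

lemma eps_ne_zero (α : Fin 3) : eps α ≠ 0 := by
  fin_cases α <;> simp [eps]

lemma IsCanonicalLocalBasis.mem (hJ : IsCanonicalLocalBasis σ.toFun U J) (hx : x ∈ U)
    (α : Fin 3) : J α x ∈ σ.toFun x :=
  hJ.span_eq x hx ▸ Submodule.subset_span ⟨α, rfl⟩

lemma IsAdapted.skew_of_isCanonicalLocalBasis (hg : IsAdapted σ g)
    (hJ : IsCanonicalLocalBasis σ.toFun U J) (hx : x ∈ U) (α : Fin 3)
    (v w : TangentSpace (𝓡 d) x) : g.toFun x (J α x v) w = -g.toFun x v (J α x w) := by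
  have hsq : J α x (J α x w) = -eps α • w := congr($(hJ.sq x hx α) w)
  have hadapted := hg U J hJ x hx α v (J α x w)
  rw [hsq, map_smul, smul_eq_mul, neg_mul] at hadapted
  exact mul_left_cancel₀ (eps_ne_zero α) (by linarith)

lemma mdifferentiableAt_metric_apply {X Y : ∀ x : M, TangentSpace (𝓡 d) x} (hX : VFDiffAt X x)
    (hY : VFDiffAt Y x) :
    MDifferentiableAt (𝓡 d) 𝓘(ℝ, ℝ) (fun y ↦ g.toFun y (X y) (Y y)) x :=
  (mdifferentiableAt_section _ _).1 (MDifferentiableAt.clm_bundle_apply₂ (b := fun y ↦ y)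
    (E₃ := fun _ : M ↦ ℝ) (F₃ := ℝ) ((g.contMDiff x).mdifferentiableAt (by simp)) hX hY)

lemma VFDiffAt.end_apply {S : EndField d M} (hU : IsOpen U) (hS : SmoothEndOn S U) (hx : x ∈ U)
    {Y : ∀ x : M, TangentSpace (𝓡 d) x} (hY : VFDiffAt Y x) : VFDiffAt (fun y ↦ S y (Y y)) x :=
  MDifferentiableAt.clm_bundle_apply (b := fun y ↦ y)
    ((hS.contMDiffAt (hU.mem_nhds hx)).mdifferentiableAt (by simp)) hY

variable {cov : CovariantDerivative (𝓡 d) (EuclideanSpace ℝ (Fin d))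
  (TangentSpace (𝓡 d) : M → Type _)}

lemma IsLeviCivita.cov_sub_cov (hLC : IsLeviCivita g cov) {X Y : ∀ x : M, TangentSpace (𝓡 d) x}
    (hX : VFDiffAt X x) (hY : VFDiffAt Y x) :
    cov Y x (X x) - cov X x (Y x) = VectorField.mlieBracket (𝓡 d) X Y x :=
  (CovariantDerivative.torsion_eq_zero_iff cov).1 hLC.torsion_eq_zero hX hY

lemma IsLeviCivita.exists_mvfderiv_metric_end_apply (hLC : IsLeviCivita g cov)
    (hpar : IsParallel σ cov) {S : EndField d M} (hU : IsOpen U) (hS : SmoothEndOn S U)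
    (hSσ : ∀ y ∈ U, S y ∈ σ.toFun y) (hx : x ∈ U) (v : TangentSpace (𝓡 d) x) :
    ∃ B ∈ σ.toFun x, ∀ Y Z : (∀ x : M, TangentSpace (𝓡 d) x), VFDiffAt Y x → VFDiffAt Z x →
      mvfderiv (𝓡 d) (fun y ↦ g.toFun y (S y (Y y)) (Z y)) x v =
        g.toFun x (B (Y x)) (Z x) + g.toFun x (S x (cov Y x v)) (Z x) +
          g.toFun x (S x (Y x)) (cov Z x v) := by
  obtain ⟨B, hB, hcov⟩ := hpar U S hU hS hSσ x hx v
  refine ⟨B, hB, fun Y Z hY hZ ↦ ?_⟩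
  rw [hLC.metric x v _ _ (hY.end_apply hU hS hx) hZ, hcov Y hY, map_sub,
    sub_apply, sub_add_cancel]

end Ambient

section Submanifold

variable {d : ℕ} {M : Type*} [TopologicalSpace M] [ChartedSpace (EuclideanSpace ℝ (Fin d)) M]
  [IsManifold (𝓡 d) ∞ M] {σ : AlmostParaquaternionicStructure d M} {g : SemiRiemannianMetric d M}
  {n : ℕ} {N : Type*} [TopologicalSpace N] [ChartedSpace (EuclideanSpace ℝ (Fin n)) N]
  [IsManifold (𝓡 n) ∞ N] {ι : N → M} {r : ℕ} {D : ∀ x : N, Submodule ℝ (TangentSpace (𝓡 n) x)}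
  {U : Set M} {J : Fin 3 → EndField d M} {x : N}
  {cov : CovariantDerivative (𝓡 d) (EuclideanSpace ℝ (Fin d)) (TangentSpace (𝓡 d) : M → Type _)}

namespace IsParaquaternionicCRSubmanifold

lemma mem_orthDistribution_iff (hN : IsParaquaternionicCRSubmanifold σ g ι r D)
    (hg : IsAdapted σ g) (hJ : IsCanonicalLocalBasis σ.toFun U J) (hx : ι x ∈ U) (α : Fin 3)
    {v : TangentSpace (𝓡 n) x} :
    v ∈ orthDistribution g ι D x ↔
      IsNormalAt n g ι x (J α (ι x) (mfderiv (𝓡 n) (𝓡 d) ι x v)) := by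
  refine ⟨hN.totallyReal U J hJ x hx α v, fun hv w hw ↦ ?_⟩
  obtain ⟨_, ⟨u, -, rfl⟩, huw⟩ := (hN.paraquaternionic U J hJ x hx α).ge (mem_image_of_mem _ hw)
  have hvu := hv u
  rwa [hg.skew_of_isCanonicalLocalBasis hJ hx, neg_eq_zero, huw] at hvu

lemma isNormalAt_of_mem (hN : IsParaquaternionicCRSubmanifold σ g ι r D)
    {B : TangentSpace (𝓡 d) (ι x) →L[ℝ] TangentSpace (𝓡 d) (ι x)} (hB : B ∈ σ.toFun (ι x))
    {v : TangentSpace (𝓡 n) x} (hv : v ∈ orthDistribution g ι D x) :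
    IsNormalAt n g ι x (B (mfderiv (𝓡 n) (𝓡 d) ι x v)) := by
  obtain ⟨U, J, hx, hJ⟩ := σ.exists_basis (ι x)
  intro w
  rw [← hJ.span_eq _ hx] at hB
  induction hB using Submodule.span_induction with
  | mem B h =>
    obtain ⟨α, rfl⟩ := h
    exact hN.totallyReal U J hJ x hx α v hv w
  | zero => simp
  | add B C _ _ hB hC => simp only [add_apply, map_add, hB, hC, add_zero]
  | smul a B _ hB => simp only [smul_apply, map_smul, hB, smul_zero]

lemma metric_end_cov_eq_neg (hN : IsParaquaternionicCRSubmanifold σ g ι r D)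
    (hLC : IsLeviCivita g cov) (hpar : IsParallel σ cov) {S : EndField d M} (hU : IsOpen U)
    (hS : SmoothEndOn S U) (hSσ : ∀ y ∈ U, S y ∈ σ.toFun y) (hx : ι x ∈ U)
    {Y Z : ∀ x : N, TangentSpace (𝓡 n) x} {Y' Z' : ∀ x : M, TangentSpace (𝓡 d) x}
    (hYY' : IsRelatedAt ι x Y Y') (hZZ' : IsRelatedAt ι x Z Z') (hY' : VFDiffAt Y' (ι x))
    (hZ' : VFDiffAt Z' (ι x)) (hYD : ∀ᶠ y in 𝓝 x, Y y ∈ orthDistribution g ι D y)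
    (v : TangentSpace (𝓡 n) x) :
    g.toFun (ι x) (S (ι x) (cov Y' (ι x) (mfderiv (𝓡 n) (𝓡 d) ι x v))) (Z' (ι x)) =
      -g.toFun (ι x) (S (ι x) (Y' (ι x))) (cov Z' (ι x) (mfderiv (𝓡 n) (𝓡 d) ι x v)) := by
  obtain ⟨B, hB, hderiv⟩ := hLC.exists_mvfderiv_metric_end_apply hpar hU hS hSσ hx
    (mfderiv (𝓡 n) (𝓡 d) ι x v)
  have hι : MDifferentiable (𝓡 n) (𝓡 d) ι := hN.isImmersion.contMDiff.mdifferentiable (by simp)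
  have hform : (fun y ↦ g.toFun y (S y (Y' y)) (Z' y)) ∘ ι =ᶠ[𝓝 x] fun _ ↦ 0 := by
    filter_upwards [hYY', hZZ', hYD, (hι x).continuousAt.preimage_mem_nhds (hU.mem_nhds hx)]
      with y hYy hZy hyD hyU
    rw [Function.comp_apply, ← hYy, ← hZy]
    exact hN.isNormalAt_of_mem (hSσ _ hyU) hyD (Z y)
  have hdiff := mdifferentiableAt_metric_apply (g := g) (hY'.end_apply hU hS hx) hZ'
  have hzero : mvfderiv (𝓡 d) (fun y ↦ g.toFun y (S y (Y' y)) (Z' y)) (ι x)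
      (mfderiv (𝓡 n) (𝓡 d) ι x v) = 0 :=
    congr($((mvfderiv_comp x hdiff (hι x)).symm.trans
      (congrArg _ hform.mfderiv_eq |>.trans (mvfderiv_const 0))) v)
  have hBY : g.toFun (ι x) (B (Y' (ι x))) (Z' (ι x)) = 0 := by
    rw [← hYY'.self_of_nhds, ← hZZ'.self_of_nhds]
    exact hN.isNormalAt_of_mem hB hYD.self_of_nhds (Z x)
  rw [hderiv Y' Z' hY' hZ', hBY, zero_add] at hzero
  exact eq_neg_of_add_eq_zero_left hzero

lemma metric_end_cov_comm (hN : IsParaquaternionicCRSubmanifold σ g ι r D)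
    (hLC : IsLeviCivita g cov) {B : TangentSpace (𝓡 d) (ι x) →L[ℝ] TangentSpace (𝓡 d) (ι x)}
    (hB : B ∈ σ.toFun (ι x)) {v w : TangentSpace (𝓡 n) x} (hv : v ∈ orthDistribution g ι D x)
    {Y Z : ∀ x : M, TangentSpace (𝓡 d) x} (hY : VFDiffAt Y (ι x)) (hZ : VFDiffAt Z (ι x))
    (hYZ : mfderiv (𝓡 n) (𝓡 d) ι x w = VectorField.mlieBracket (𝓡 d) Y Z (ι x)) :
    g.toFun (ι x) (B (mfderiv (𝓡 n) (𝓡 d) ι x v)) (cov Z (ι x) (Y (ι x))) =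
      g.toFun (ι x) (B (mfderiv (𝓡 n) (𝓡 d) ι x v)) (cov Y (ι x) (Z (ι x))) := by
  rw [← sub_eq_zero, ← map_sub, hLC.cov_sub_cov hY hZ, ← hYZ]
  exact hN.isNormalAt_of_mem hB hv w

lemma metric_end_mlieBracket_eq_zero (hN : IsParaquaternionicCRSubmanifold σ g ι r D)
    (hg : IsAdapted σ g) (hLC : IsLeviCivita g cov) (hpar : IsParallel σ cov)
    (hJ : IsCanonicalLocalBasis σ.toFun U J) (hx : ι x ∈ U) (α : Fin 3)
    {X Y Z : ∀ x : N, TangentSpace (𝓡 n) x} {X' Y' Z' : ∀ x : M, TangentSpace (𝓡 d) x}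
    (hXX' : IsRelatedAt ι x X X') (hYY' : IsRelatedAt ι x Y Y') (hZZ' : IsRelatedAt ι x Z Z')
    (hX' : VFDiffAt X' (ι x)) (hY' : VFDiffAt Y' (ι x)) (hZ' : VFDiffAt Z' (ι x))
    (hXD : ∀ᶠ y in 𝓝 x, X y ∈ orthDistribution g ι D y)
    (hYD : ∀ᶠ y in 𝓝 x, Y y ∈ orthDistribution g ι D y) {v w : TangentSpace (𝓡 n) x}
    (hXZ : mfderiv (𝓡 n) (𝓡 d) ι x v = VectorField.mlieBracket (𝓡 d) X' Z' (ι x))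
    (hYZ : mfderiv (𝓡 n) (𝓡 d) ι x w = VectorField.mlieBracket (𝓡 d) Y' Z' (ι x)) :
    g.toFun (ι x) (J α (ι x) (VectorField.mlieBracket (𝓡 d) X' Y' (ι x))) (Z' (ι x)) = 0 := by
  let Ω (u v : TangentSpace (𝓡 d) (ι x)) : ℝ := g.toFun (ι x) (J α (ι x) u) v
  let nabla (V W : ∀ x : M, TangentSpace (𝓡 d) x) := cov W (ι x) (V (ι x))
  have hskew u v : Ω u v = -Ω v u :=
    (hg.skew_of_isCanonicalLocalBasis hJ hx α u v).trans (congrArg _ (g.symm _ _ _))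
  have hparallel {V Y Z : ∀ x : N, TangentSpace (𝓡 n) x} {V' Y' Z'} (hVV' : IsRelatedAt ι x V V')
      (hYY' : IsRelatedAt ι x Y Y') (hZZ' : IsRelatedAt ι x Z Z') (hY' : VFDiffAt Y' (ι x))
      (hZ' : VFDiffAt Z' (ι x))
      (hYD : ∀ᶠ y in 𝓝 x, Y y ∈ orthDistribution g ι D y) :
      Ω (nabla V' Y') (Z' (ι x)) = -Ω (Y' (ι x)) (nabla V' Z') := by
    simp only [Ω, nabla, ← hVV'.self_of_nhds]
    exact hN.metric_end_cov_eq_neg hLC hpar hJ.isOpen (hJ.smooth α) (fun _ hy ↦ hJ.mem hy α) hx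
      hYY' hZZ' hY' hZ' hYD (V x)
  have hcommX : Ω (X' (ι x)) (nabla Y' Z') = Ω (X' (ι x)) (nabla Z' Y') := by
    simp only [Ω, nabla, ← hXX'.self_of_nhds]
    exact hN.metric_end_cov_comm hLC (hJ.mem hx α) hXD.self_of_nhds hY' hZ' hYZ
  have hcommY : Ω (Y' (ι x)) (nabla X' Z') = Ω (Y' (ι x)) (nabla Z' X') := by
    simp only [Ω, nabla, ← hYY'.self_of_nhds]
    exact hN.metric_end_cov_comm hLC (hJ.mem hx α) hYD.self_of_nhds hX' hZ' hXZ
  calc Ω (VectorField.mlieBracket (𝓡 d) X' Y' (ι x)) (Z' (ι x))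
    _ = Ω (nabla X' Y') (Z' (ι x)) - Ω (nabla Y' X') (Z' (ι x)) := by
      simp only [Ω, nabla, ← hLC.cov_sub_cov hX' hY', map_sub, sub_apply]
    _ = Ω (X' (ι x)) (nabla Y' Z') - Ω (Y' (ι x)) (nabla X' Z') := by
      rw [hparallel hXX' hYY' hZZ' hY' hZ' hYD, hparallel hYY' hXX' hZZ' hX' hZ' hXD]
      ring
    _ = Ω (X' (ι x)) (nabla Z' Y') + Ω (nabla Z' Y') (X' (ι x)) := by
      rw [hcommX, hcommY, hparallel hZZ' hYY' hXX' hY' hX' hYD, sub_eq_add_neg]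
    _ = 0 := by
      rw [hskew, neg_add_cancel]

theorem isInvolutive_orthDistribution (hN : IsParaquaternionicCRSubmanifold σ g ι r D)
    (hM : IsParaquaternionicKahler σ g) : IsInvolutive (orthDistribution g ι D) := by
  intro W X Y hW hX hY hXD hYD x hx
  obtain ⟨cov, hLC, hpar⟩ := hM.parallel
  obtain ⟨U, J, hxU, hJ⟩ := σ.exists_basis (ι x)
  refine (hN.mem_orthDistribution_iff hM.adapted hJ hxU 0).2 fun w ↦ ?_
  obtain ⟨O, hO, hxO, Z, hZ, rfl⟩ := exists_vfSmoothOn_apply_eq x w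
  have hWx : W ∈ 𝓝 x := hW.mem_nhds hx
  replace hX : VFSmoothOn X (W ∩ O) := hX.mono inter_subset_left
  replace hY : VFSmoothOn Y (W ∩ O) := hY.mono inter_subset_left
  replace hZ : VFSmoothOn Z (W ∩ O) := hZ.mono inter_subset_right
  obtain ⟨ext, hrel, hsmooth, hbracket⟩ :=
    exists_related_fields hN.isImmersion (Filter.inter_mem hWx (hO.mem_nhds hxO))
  have hdiff {X} (hX : VFSmoothOn X (W ∩ O)) : VFDiffAt (ext X) (ι x) :=
    (hsmooth X hX).mdifferentiableAt (by simp)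
  rw [hbracket X Y hX hY, (hrel Z).self_of_nhds]
  exact hN.metric_end_mlieBracket_eq_zero hM.adapted hLC hpar hJ hxU 0 (hrel X) (hrel Y) (hrel Z)
    (hdiff hX) (hdiff hY) (hdiff hZ) (Filter.eventually_of_mem hWx hXD)
    (Filter.eventually_of_mem hWx hYD) (hbracket X Z hX hZ) (hbracket Y Z hY hZ)

end IsParaquaternionicCRSubmanifold

end Submanifold

end ParaquaternionicCR

end

theorem mainTheorem1
    {d : ℕ} {M : Type*} [TopologicalSpace M] [T2Space M]
    [ChartedSpace (EuclideanSpace ℝ (Fin d)) M] [IsManifold (𝓡 d) ∞ M]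
    (σ : ParaquaternionicCR.AlmostParaquaternionicStructure d M)
    (g : ParaquaternionicCR.SemiRiemannianMetric d M)
    (hM : ParaquaternionicCR.IsParaquaternionicKahler σ g)
    {n : ℕ} {N : Type*} [TopologicalSpace N] [T2Space N]
    [ChartedSpace (EuclideanSpace ℝ (Fin n)) N] [IsManifold (𝓡 n) ∞ N]
    (ι : N → M) (r : ℕ) (D : ∀ x : N, Submodule ℝ (TangentSpace (𝓡 n) x))
    (hN : ParaquaternionicCR.IsParaquaternionicCRSubmanifold σ g ι r D) :
    ParaquaternionicCR.IsInvolutive (ParaquaternionicCR.orthDistribution g ι D) ∧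
    ParaquaternionicCR.IsIntegrable (n - r) (ParaquaternionicCR.orthDistribution g ι D) ∧
    ∃! F : ParaquaternionicCR.Foliation n N (n - r),
      F.HasStructuralDistribution (ParaquaternionicCR.orthDistribution g ι D) := by
  have hinv := hN.isInvolutive_orthDistribution hM
  have hint := hinv.isIntegrable
    (hN.isDistribution.orthDistribution hN.isImmersion hN.nondegenerate
      hN.nondegenerate_distribution)
  exact ⟨hinv, hint, hint.existsUnique_foliation⟩
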